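/- Let $N\ge 2$ be an integer, let $M>0$ be real, and put $\mu=\frac{M}{M+1}$, $\eta=\frac{M+1}{M+2}$ and $$\gamma_c=\frac{2(M+1)}{\pi}\arcsin\!\Big(\frac1{M+1}\Big)-\frac{2\sqrt{M(M+2)}}{\pi(N-1)(M+1)}.$$ Let $\gamma\in\mathbb R$. Let $P_\ell(y)=\frac1{2^\ell\ell!}\frac{d^\ell}{dy^\ell}(y^2-1)^\ell$ be the Legendre polynomial of degree $\ell$. For $\ell\in\mathbb N_0$, $\zeta\ge 0$ and $\psi\in L^2(\mathbb R_+,p^2\sqrt{p^2+1}\,dp)$ (complex valued) define $$F^{\zeta}_{\mathrm{diag}}[\psi]=\int_0^\infty k^2\sqrt{\tfrac{\mu}{\eta}k^2+\zeta}\;|\psi(k)|^2\,dk,$$ $$F_{\mathrm{reg};\ell}[\psi]=\frac{(N-1)\gamma}{\pi}\int_0^\infty\! p^2\,dp\int_0^\infty\! q^2\,\overline{\psi(p)}\,\psi(q)\,dq\int_{-1}^1\frac{P_\ell(y)}{p^2+q^2-2pqy}\,dy,$$ $$F^{\zeta}_{\mathrm{off};\ell}[\psi]=-\frac{N-1}{\pi}\int_0^\infty\!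 p^2\,dp\int_0^\infty\! q^2\,\overline{\psi(p)}\,\psi(q)\,dq\int_{-1}^1\frac{P_\ell(y)}{p^2+q^2+\frac{2}{M+1}pqy+\zeta}\,dy.$$ If $\gamma>\gamma_c$, then there are numbers $s_\ell\in(0,1)$, $\ell\in\mathbb N_0$, which can be chosen independent of $\ell$ (that is, $s_\ell=s$ for one $s\in(0,1)$), such that for every $\ell\in\mathbb N_0$, every $\zeta\ge 0$ and every $\psi\in L^2(\mathbb R_+,p^2\sqrt{p^2+1}\,dp)$ the integrals that define the auxiliary form $$\Xi^{\zeta}_{\ell,s_\ell}[\psi]=s_\ell F^{\zeta}_{\mathrm{diag}}[\psi]+F^{0}_{\mathrm{off};\ell}[\psi]+F_{\mathrm{reg};\ell}[\psi]$$ converge absolutely, its value is real, and $\Xi^{\zeta}_{\ell,s_\ell}[\psi]\ge 0$. -/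

import Mathlib

open MeasureTheory Set

namespace ImpurityGas

/-- Reduced mass of the impurity-boson pair. -/
noncomputable def redMass (M : ℝ) : ℝ := M / (M + 1)

/-- Modified reduced mass. -/
noncomputable def modRedMass (M : ℝ) : ℝ := (M + 1) / (M + 2)

/-- The critical parameter `γ_c`. -/
noncomputable def gammaC (N : ℕ) (M : ℝ) : ℝ :=
  2 * (M + 1) / Real.pi * Real.arcsin (1 / (M + 1))
    - 2 * Real.sqrt (M * (M + 2)) / (Real.pi * ((N : ℝ) - 1) * (M + 1))

/-- The Legendre polynomial of degree `l`, by the formula of Rodrigues. -/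
noncomputable def legendreP (l : ℕ) : Polynomial ℝ :=
  Polynomial.C (1 / (2 ^ l * (l.factorial : ℝ))) *
    Polynomial.derivative^[l] ((Polynomial.X ^ 2 - 1) ^ l)

/-- Lebesgue measure on the open half-line. -/
noncomputable def halfLine : Measure ℝ := volume.restrict (Ioi 0)

/-- The measure `p² √(p² + 1) dp` on the open half-line. The form domain is its `L²` space. -/
noncomputable def domMeasure : Measure ℝ :=
  halfLine.withDensity fun p => ENNReal.ofReal (p ^ 2 * Real.sqrt (p ^ 2 + 1))

/-- The angular kernel of the regularizing form, before integration over `y ∈ [-1, 1]`. -/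
noncomputable def regKernel (l : ℕ) (p q y : ℝ) : ℝ :=
  (legendreP l).eval y / (p ^ 2 + q ^ 2 - 2 * p * q * y)

/-- The angular kernel of the off-diagonal form, before integration over `y ∈ [-1, 1]`. -/
noncomputable def offKernel (M ζ : ℝ) (l : ℕ) (p q y : ℝ) : ℝ :=
  (legendreP l).eval y / (p ^ 2 + q ^ 2 + 2 / (M + 1) * p * q * y + ζ)

/-- `∫ p² dp ∫ q² conj (ψ p) ψ q dq ∫_{-1}^{1} K p q y dy`, with `p` and `q` over the half-line. -/
noncomputable def kernelForm (K : ℝ → ℝ → ℝ → ℝ) (ψ : ℝ → ℂ) : ℂ :=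
  ∫ p, (p : ℂ) ^ 2 * ∫ q, (q : ℂ) ^ 2 * (starRingEnd ℂ (ψ p) * ψ q) *
    ((∫ y in (-1 : ℝ)..1, K p q y : ℝ) : ℂ) ∂halfLine ∂halfLine

/-- Absolute convergence of the triple integral in `kernelForm`. -/
def KernelFormConverges (K : ℝ → ℝ → ℝ → ℝ) (ψ : ℝ → ℂ) : Prop :=
  Integrable (fun x : ℝ × ℝ × ℝ => (x.1 : ℂ) ^ 2 * (x.2.1 : ℂ) ^ 2 *
      (starRingEnd ℂ (ψ x.1) * ψ x.2.1) * (K x.1 x.2.1 x.2.2 : ℂ))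
    (halfLine.prod (halfLine.prod (volume.restrict (Icc (-1) 1))))

/-- The integrand of the diagonal form. -/
noncomputable def diagIntegrand (M ζ : ℝ) (ψ : ℝ → ℂ) (k : ℝ) : ℝ :=
  k ^ 2 * Real.sqrt (redMass M / modRedMass M * k ^ 2 + ζ) * ‖ψ k‖ ^ 2

/-- The diagonal form `F^ζ_diag`. -/
noncomputable def Fdiag (M ζ : ℝ) (ψ : ℝ → ℂ) : ℝ := ∫ k, diagIntegrand M ζ ψ k ∂halfLine

/-- The off-diagonal form `F^ζ_{off;l}`. -/
noncomputable def Foff (N : ℕ) (M ζ : ℝ) (l : ℕ) (ψ : ℝ → ℂ) : ℂ :=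
  -((((N : ℝ) - 1) / Real.pi : ℝ) : ℂ) * kernelForm (offKernel M ζ l) ψ

/-- The regularizing form `F_{reg;l}`. -/
noncomputable def Freg (N : ℕ) (γ : ℝ) (l : ℕ) (ψ : ℝ → ℂ) : ℂ :=
  ((((N : ℝ) - 1) * γ / Real.pi : ℝ) : ℂ) * kernelForm (regKernel l) ψ

/-- The auxiliary form `s F^ζ_diag + F^0_{off;l} + F_{reg;l}`. -/
noncomputable def auxForm (N : ℕ) (M γ s ζ : ℝ) (l : ℕ) (ψ : ℝ → ℂ) : ℂ :=
  ((s * Fdiag M ζ ψ : ℝ) : ℂ) + Foff N M 0 l ψ + Freg N γ l ψ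

/-- All the integrals that define the auxiliary form at `ψ` converge absolutely. -/
def AuxFormConverges (M ζ : ℝ) (l : ℕ) (ψ : ℝ → ℂ) : Prop :=
  Integrable (diagIntegrand M ζ ψ) halfLine ∧
    KernelFormConverges (offKernel M 0 l) ψ ∧ KernelFormConverges (regKernel l) ψ

end ImpurityGas

/-! Put `f p = p² ψ p` and `E = ∫ ‖f p‖² / p`, and expand `1 / (p² + q² - 2bpqy)` as a geometric
series in `by`. The regularizing form (`b = 1`) and the off-diagonal form at zero energy (`b = -a`,
`a = 1/(M+1)`) become `R = ∑ mₙ tₙ` and `O = ∑ (-a)ⁿ mₙ tₙ`, where `mₙ` is the `n`-th moment of `Pₗ`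
and `tₙ` the quadratic form of the kernel `(2pq)ⁿ/(p²+q²)ⁿ⁺¹` at `f` (`hasSum_kernelForm`). It
remains to bound `γ R - O` from below by a multiple of `E`.

The moments are nonnegative and vanish for `l + n` odd; the `tₙ` are nonnegative. For odd `l` only
odd `n` contribute, so `O ≤ 0 ≤ R`, and `γ > γ_c > 0` suffices.

For even `l` only even `n` contribute. The case `mₙ = 2/(n+1)`, `tₙ = wₙ`, with `wₙ` the mass of the
kernel, can be summed: it gives the arcsine series, and `balance a` is the ratio of `O` to `R`
there. In general both `(n+1) mₙ` and `tₙ/wₙ` are nondecreasing along even `n`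
(`legendreMoment_step`, `exists_powForm_sub_eq`), so the actual series puts more weight on large
`n`, where `aⁿ` is small. A Chebyshev type inequality then yields `O ≤ balance a * R`
(`le_balance_mul`).

If `γ < balance a`, the remaining loss `(balance a - γ) R` is controlled by `R ≤ (π²/2) E`,
uniformly in `l` (`regularizing_le`). The diagonal form is at least `√(M(M+2))/(M+1) * E`, and `γ >
γ_c` says exactly that a fraction `s < 1` of it pays for that loss (`balance_coercive`). -/

namespace ImpurityGas

/-! ### Homogeneous kernels and the recursion for their masses. -/

/-- The homogeneous kernel `(2pq)ⁿ / (p² + q²)ⁿ⁺¹`. -/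
noncomputable def powKernel (n : ℕ) (p q : ℝ) : ℝ := (2 * p * q) ^ n / (p ^ 2 + q ^ 2) ^ (n + 1)

/-- The mass `∫ (2q)ⁿ / (1 + q²)ⁿ⁺¹ dq` over the half-line of the homogeneous kernel. -/
noncomputable def powMass (n : ℕ) : ℝ := ∫ q, powKernel n 1 q ∂halfLine

theorem ae_halfLine_pos : ∀ᵐ p ∂halfLine, 0 < p := ae_restrict_mem measurableSet_Ioi

theorem measurable_powKernel (n : ℕ) : Measurable fun x : ℝ × ℝ => powKernel n x.1 x.2 := by
  unfold powKernel; fun_prop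

theorem powKernel_nonneg (n : ℕ) {p q : ℝ} (hp : 0 ≤ p) (hq : 0 ≤ q) : 0 ≤ powKernel n p q := by
  unfold powKernel; positivity

theorem powKernel_comm (n : ℕ) (p q : ℝ) : powKernel n p q = powKernel n q p := by
  unfold powKernel; rw [add_comm (p ^ 2), mul_right_comm]

theorem powKernel_succ_le (n : ℕ) {p q : ℝ} (hp : 0 < p) (hq : 0 < q) :
    powKernel (n + 1) p q ≤ powKernel n p q := by
  unfold powKernel
  have hA : 0 < p ^ 2 + q ^ 2 := by positivity
  rw [div_le_div_iff₀ (by positivity) (by positivity), pow_succ, pow_succ (p ^ 2 + q ^ 2) (n + 1)]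
  have : 2 * p * q ≤ p ^ 2 + q ^ 2 := by nlinarith [sq_nonneg (p - q)]
  calc _ = (2 * p * q) ^ n * (p ^ 2 + q ^ 2) ^ (n + 1) * (2 * p * q) := by ring
    _ ≤ (2 * p * q) ^ n * (p ^ 2 + q ^ 2) ^ (n + 1) * (p ^ 2 + q ^ 2) := by gcongr
    _ = _ := by ring

theorem powKernel_zero_one (q : ℝ) : powKernel 0 1 q = (1 + q ^ 2)⁻¹ := by
  simp [powKernel]

theorem powKernel_le_zero (n : ℕ) {p q : ℝ} (hp : 0 < p) (hq : 0 < q) :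
    powKernel n p q ≤ powKernel 0 p q := by
  induction n with
  | zero => rfl
  | succ n ih => exact (powKernel_succ_le n hp hq).trans ih

theorem integrable_powKernel_one (n : ℕ) : Integrable (powKernel n 1) halfLine := by
  have h0 : Integrable (fun q : ℝ => (1 + q ^ 2)⁻¹) halfLine :=
    integrable_inv_one_add_sq.mono_measure Measure.restrict_le_self
  refine h0.mono' ((measurable_powKernel n).comp
    (measurable_const.prodMk measurable_id)).aestronglyMeasurable ?_
  filter_upwards [ae_halfLine_pos] with q hq
  rw [Real.norm_of_nonneg (powKernel_nonneg n zero_le_one hq.le), ← powKernel_zero_one]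
  exact powKernel_le_zero n one_pos hq

theorem powKernel_scale (n : ℕ) {p : ℝ} (hp : 0 < p) (q : ℝ) :
    powKernel n p q = (p ^ 2)⁻¹ * powKernel n 1 (p⁻¹ * q) := by
  unfold powKernel
  have : p ^ 2 + q ^ 2 = p ^ 2 * (1 ^ 2 + (p⁻¹ * q) ^ 2) := by field_simp
  rw [this, mul_pow (p ^ 2), show 2 * p * q = p ^ 2 * (2 * 1 * (p⁻¹ * q)) by field_simp,
    mul_pow (p ^ 2), pow_succ (p ^ 2) n]
  have h1 : 0 < 1 ^ 2 + (p⁻¹ * q) ^ 2 := by positivity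
  field_simp

/-- Homogeneity of degree `-2` reduces every row to `p = 1`. The factor `1 / p` is the source of the
weight in `E`. -/
theorem integral_powKernel (n : ℕ) {p : ℝ} (hp : 0 < p) :
    ∫ q, powKernel n p q ∂halfLine = powMass n / p := by
  simp_rw [powKernel_scale n hp]
  rw [integral_const_mul, halfLine, integral_comp_mul_left_Ioi _ _ (inv_pos.2 hp), mul_zero,
    inv_inv, smul_eq_mul, powMass, halfLine]
  field_simp

theorem integrable_powKernel (n : ℕ) {p : ℝ} (hp : 0 < p) :
    Integrable (powKernel n p) halfLine := by
  have h := integrable_powKernel_one n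
  have : Integrable (fun q => powKernel n 1 (p⁻¹ * q)) halfLine := by
    have := (integrableOn_Ioi_comp_mul_left_iff (powKernel n 1) 0 (inv_pos.2 hp)).2
      (by simpa [halfLine, IntegrableOn] using h)
    exact this
  refine (this.const_mul (p ^ 2)⁻¹).congr (ae_of_all _ fun q => ?_)
  exact (powKernel_scale n hp q).symm

theorem powMass_zero : powMass 0 = Real.pi / 2 := by
  simp_rw [powMass, powKernel_zero_one, halfLine]
  rw [integral_Ioi_inv_one_add_sq]; simp

theorem powMass_nonneg (n : ℕ) : 0 ≤ powMass n := by
  refine integral_nonneg_of_ae ?_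
  filter_upwards [ae_halfLine_pos] with q hq using powKernel_nonneg n zero_le_one hq.le

theorem powMass_succ_le (n : ℕ) : powMass (n + 1) ≤ powMass n := by
  refine integral_mono_ae (integrable_powKernel_one _) (integrable_powKernel_one _) ?_
  filter_upwards [ae_halfLine_pos] with q hq using powKernel_succ_le n one_pos hq

/-- This function vanishes at `0` and at infinity, so integrating its derivative gives the two-step
recursion for the masses. -/
theorem hasDerivAt_powKernel_primitive (n : ℕ) (x : ℝ) : HasDerivAt
    (fun q : ℝ => (q ^ 2 - 1) * (2 ^ n * q ^ (n + 1)) / (1 + q ^ 2) ^ (n + 2))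
    ((n + 2) * powKernel (n + 2) 1 x - (n + 1) * powKernel n 1 x) x := by
  have hA : 1 + x ^ 2 ≠ 0 := by positivity
  have h1 : HasDerivAt (fun q : ℝ => 1 + q ^ 2) (2 * x) x := by
    simpa using (hasDerivAt_pow 2 x).const_add 1
  have h2 : HasDerivAt (fun q : ℝ => q ^ 2 - 1) (2 * x) x := by
    simpa using (hasDerivAt_pow 2 x).sub_const 1
  have h3 := (hasDerivAt_pow (n + 1) x).const_mul (2 ^ n)
  refine ((h2.fun_mul h3).fun_div (h1.fun_pow (n + 2)) (pow_ne_zero _ hA)).congr_deriv ?_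
  simp only [powKernel, Nat.add_sub_cancel, show n + 2 - 1 = n + 1 from rfl, one_pow, mul_one]
  push_cast
  rw [mul_pow, mul_pow, pow_add x n 2, pow_succ x n,
    show n + 2 + 1 = n + 1 + 2 from rfl, pow_add _ (n + 1) 2, pow_succ _ (n + 1)]
  have := pow_ne_zero (n + 1) hA
  field_simp
  ring

theorem powMass_add_two (n : ℕ) : (n + 2) * powMass (n + 2) = (n + 1) * powMass n := by
  have hlim : Filter.Tendsto
      (fun q : ℝ => (q ^ 2 - 1) * (2 ^ n * q ^ (n + 1)) / (1 + q ^ 2) ^ (n + 2)) Filter.atTop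
      (nhds 0) := by
    refine squeeze_zero_norm' ?_ tendsto_inv_atTop_zero
    filter_upwards [Filter.eventually_ge_atTop 1] with q hq
    have hq0 : 0 < q := by linarith
    have hK : powKernel n 1 q ≤ (1 + q ^ 2)⁻¹ :=
      powKernel_zero_one q ▸ powKernel_le_zero n one_pos hq0
    have h1 : (q ^ 2 - 1) / (1 + q ^ 2) ≤ 1 := by
      rw [div_le_one (by positivity)]; linarith
    have h0 : 0 ≤ q ^ 2 - 1 := by nlinarith
    have he : (q ^ 2 - 1) * (2 ^ n * q ^ (n + 1)) / (1 + q ^ 2) ^ (n + 2)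
        = (q ^ 2 - 1) / (1 + q ^ 2) * (q * powKernel n 1 q) := by
      simp only [powKernel, one_pow, mul_one, mul_pow]
      field_simp
      ring
    rw [Real.norm_of_nonneg (by positivity), he]
    calc _ ≤ 1 * (q * (1 + q ^ 2)⁻¹) := by
          gcongr
          exact mul_nonneg hq0.le (powKernel_nonneg n zero_le_one hq0.le)
      _ ≤ q⁻¹ := by
          rw [one_mul, ← div_eq_mul_inv, div_le_iff₀ (by positivity)]
          field_simp; linarith
  have hint := fun m => integrable_powKernel_one m
  have h := integral_Ioi_of_hasDerivAt_of_tendsto'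
    (fun x (_ : x ∈ Ici (0 : ℝ)) => hasDerivAt_powKernel_primitive n x)
    (((hint (n + 2)).const_mul _).sub ((hint n).const_mul _)) hlim
  change ∫ x, _ ∂halfLine = _ at h
  rw [integral_sub ((hint _).const_mul _) ((hint _).const_mul _), integral_const_mul,
    integral_const_mul] at h
  rw [zero_pow n.succ_ne_zero] at h
  simp only [mul_zero, zero_div, sub_zero] at h
  exact sub_eq_zero.1 h

/-! ### The masses as coefficients of the arcsine series. -/

theorem powMass_even (k : ℕ) :
    powMass (2 * k) = Real.pi / 2 * Ring.choose ((1 / 2 : ℝ) + k - 1) k := by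
  have hrec : ∀ k : ℕ, (k + 1) * Ring.choose ((1 / 2 : ℝ) + (k + 1 : ℕ) - 1) (k + 1)
      = (1 / 2 + k) * Ring.choose ((1 / 2 : ℝ) + k - 1) k := by
    have hmc (k : ℕ) : (k.factorial : ℝ) * Ring.choose ((1 / 2 : ℝ) + k - 1) k
        = (ascPochhammer ℝ k).eval (1 / 2) := by
      rw [Ring.choose, show (1 / 2 : ℝ) + k - 1 - k + 1 = 1 / 2 by ring, ← nsmul_eq_mul,
        Ring.factorial_nsmul_multichoose_eq_ascPochhammer, Polynomial.ascPochhammer_smeval_eq_eval]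
    intro k
    have h1 := hmc (k + 1)
    rw [ascPochhammer_succ_eval, ← hmc k, Nat.factorial_succ] at h1
    push_cast at h1 ⊢
    have := Nat.cast_ne_zero (R := ℝ).2 k.factorial_ne_zero
    refine mul_left_cancel₀ this ?_
    linarith
  induction k with
  | zero => simp [powMass_zero]
  | succ k ih =>
    have h1 := powMass_add_two (2 * k)
    have h2 := hrec k
    rw [ih] at h1
    have hk : (2 * (k : ℝ) + 2) ≠ 0 := by positivity
    refine mul_left_cancel₀ hk ?_
    rw [show 2 * (k + 1) = 2 * k + 2 by ring]
    push_cast at h1 h2 ⊢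
    linear_combination h1 - Real.pi * h2

/-- The even masses are `π/2` times the binomial coefficients of `(1 - z)^(-1/2)`, taken at `z =
x²`. -/
theorem hasSum_powMass_even {x : ℝ} (hx : |x| < 1) :
    HasSum (fun k : ℕ => powMass (2 * k) * x ^ (2 * k)) (Real.pi / 2 * (1 / √(1 - x ^ 2))) := by
  have hx2 : ‖x ^ 2‖ < 1 := by
    rw [norm_pow, Real.norm_eq_abs, sq_abs]; exact (sq_lt_one_iff_abs_lt_one x).2 hx
  have h := (Real.one_div_one_sub_rpow_hasFPowerSeriesOnBall_zero (1 / 2)).hasSum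
    (y := x ^ 2) (by
      rw [Metric.mem_eball, edist_zero_right, ← ofReal_norm, ENNReal.ofReal_lt_one]
      exact hx2)
  simp only [FormalMultilinearSeries.ofScalars_apply_eq, zero_add, ← Real.sqrt_eq_rpow,
    smul_eq_mul] at h
  refine (h.mul_left (Real.pi / 2)).congr_fun ?_
  intro k
  rw [powMass_even, pow_mul]; ring

/-- The power series of the arcsine, with the masses as coefficients. -/
theorem hasSum_arcsin {a : ℝ} (ha : 0 < a) (ha1 : a < 1) :
    HasSum (fun k : ℕ => powMass (2 * k) * (2 / (2 * k + 1)) * a ^ (2 * k))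
      (Real.pi * (Real.arcsin a / a)) := by
  -- Termwise integration of the binomial series over `[0, a]`; the values of the terms at `a`
  -- dominate.
  have h := intervalIntegral.hasSum_integral_of_dominated_convergence (μ := volume)
    (a := 0) (b := a) (F := fun (k : ℕ) x => powMass (2 * k) * x ^ (2 * k))
    (f := fun x => Real.pi / 2 * (1 / √(1 - x ^ 2)))
    (fun k _ => powMass (2 * k) * a ^ (2 * k))
    (fun k => by fun_prop) (fun k => ae_of_all _ fun x hx => by
      rw [uIoc_of_le ha.le] at hx
      rw [norm_mul, Real.norm_of_nonneg (powMass_nonneg _), norm_pow,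
        Real.norm_of_nonneg hx.1.le]
      exact mul_le_mul_of_nonneg_left (pow_le_pow_left₀ hx.1.le hx.2 _) (powMass_nonneg _))
    (ae_of_all _ fun x _ => (hasSum_powMass_even (by rwa [abs_of_pos ha])).summable)
    intervalIntegrable_const
    (ae_of_all _ fun x hx => by
      rw [uIoc_of_le ha.le] at hx
      exact hasSum_powMass_even (by rw [abs_of_pos hx.1]; exact hx.2.trans_lt ha1))
  have hi : ∫ x in (0 : ℝ)..a, Real.pi / 2 * (1 / √(1 - x ^ 2))
      = Real.pi / 2 * Real.arcsin a := by
    have hpos : ∀ x ∈ uIcc 0 a, 0 < 1 - x ^ 2 := fun x hx => by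
      rw [uIcc_of_le ha.le] at hx; nlinarith [hx.1, hx.2]
    rw [intervalIntegral.integral_const_mul, intervalIntegral.integral_eq_sub_of_hasDerivAt
      (f := Real.arcsin) (fun x hx => Real.hasDerivAt_arcsin
        (fun h => by simpa [h] using hpos x hx) (fun h => by simpa [h] using hpos x hx)),
      Real.arcsin_zero, sub_zero]
    refine ContinuousOn.intervalIntegrable ?_
    exact continuousOn_const.div (by fun_prop) fun x hx => (Real.sqrt_pos.2 (hpos x hx)).ne'
  rw [hi] at h
  have h2 := h.mul_left (2 / a)
  rw [show 2 / a * (Real.pi / 2 * Real.arcsin a) = Real.pi * (Real.arcsin a / a) by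
    field_simp] at h2
  refine h2.congr_fun fun k => ?_
  rw [intervalIntegral.integral_const_mul, integral_pow, zero_pow (Nat.succ_ne_zero _), pow_succ]
  push_cast
  field_simp
  ring

/-- Limit `a → 1` in the arcsine series, with `arcsin 1 = π/2`. As the terms are nonnegative, the
limit bounds all partial sums, which gives summability; termwise comparison gives the reverse bound.
-/
theorem hasSum_powMass_even_div :
    HasSum (fun k : ℕ => powMass (2 * k) * (2 / (2 * k + 1))) (Real.pi ^ 2 / 2) := by
  have h0 (k : ℕ) : 0 ≤ powMass (2 * k) * (2 / (2 * k + 1)) :=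
    mul_nonneg (powMass_nonneg _) (by positivity)
  have hlim : Filter.Tendsto (fun x : ℝ => Real.pi * (Real.arcsin x / x))
      (nhdsWithin 1 (Iio 1)) (nhds (Real.pi ^ 2 / 2)) := by
    have : ContinuousAt (fun x : ℝ => Real.pi * (Real.arcsin x / x)) 1 :=
      continuousAt_const.mul (Real.continuous_arcsin.continuousAt.div continuousAt_id one_ne_zero)
    have h := this.tendsto
    rw [Real.arcsin_one] at h
    convert h.mono_left nhdsWithin_le_nhds using 2
    ring
  have hev : ∀ᶠ x : ℝ in nhdsWithin 1 (Iio 1), 0 < x ∧ x < 1 :=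
    Ioo_mem_nhdsLT one_pos
  have hpart (F : Finset ℕ) : ∑ k ∈ F, powMass (2 * k) * (2 / (2 * k + 1)) ≤ Real.pi ^ 2 / 2 := by
    have hc : Filter.Tendsto
        (fun x : ℝ => ∑ k ∈ F, powMass (2 * k) * (2 / (2 * k + 1)) * x ^ (2 * k))
        (nhdsWithin 1 (Iio 1)) (nhds (∑ k ∈ F, powMass (2 * k) * (2 / (2 * k + 1)))) := by
      have : Continuous
          (fun x : ℝ => ∑ k ∈ F, powMass (2 * k) * (2 / (2 * k + 1)) * x ^ (2 * k)) := by
        fun_prop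
      simpa using (this.tendsto 1).mono_left nhdsWithin_le_nhds
    refine le_of_tendsto_of_tendsto hc hlim ?_
    filter_upwards [hev] with x hx
    exact sum_le_hasSum F (fun k _ => mul_nonneg (h0 k) (pow_nonneg hx.1.le _))
      (hasSum_arcsin hx.1 hx.2)
  have hs : Summable (fun k : ℕ => powMass (2 * k) * (2 / (2 * k + 1))) :=
    summable_of_sum_le h0 hpart
  convert hs.hasSum using 1
  refine le_antisymm (le_of_tendsto hlim ?_) (hs.tsum_le_of_sum_le hpart)
  filter_upwards [hev] with x hx
  exact hasSum_le (fun k => mul_le_of_le_one_right (h0 k) (pow_le_one₀ hx.1.le hx.2.le))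
    (hasSum_arcsin hx.1 hx.2) hs.hasSum

theorem summable_powMass_div : Summable fun n : ℕ => powMass n * (2 / (n + 1)) := by
  have h := hasSum_powMass_even_div.summable
  refine Summable.even_add_odd ?_ ?_
  · exact_mod_cast h
  · refine h.of_nonneg_of_le (fun k => mul_nonneg (powMass_nonneg _) (by positivity)) fun k => ?_
    push_cast
    gcongr
    · exact powMass_nonneg _
    · exact powMass_succ_le _
    · linarith

/-! ### Moments of the Legendre polynomials. -/

/-- The moments `∫ Pₗ(y) yⁿ dy` over `[-1, 1]`. -/
noncomputable def legendreMoment (l n : ℕ) : ℝ := ∫ y in (-1 : ℝ)..1, (legendreP l).eval y * y ^ n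

/-- The integral `∫ yᵐ (1 - y²)ˡ dy` over `[-1, 1]`. -/
noncomputable def betaMoment (m l : ℕ) : ℝ := ∫ y in (-1 : ℝ)..1, y ^ m * (1 - y ^ 2) ^ l

theorem eval_iterate_derivative_sq_sub_one {l j : ℕ} (h : j < l) {x : ℝ} (hx : x ^ 2 = 1) :
    (Polynomial.derivative^[j] ((Polynomial.X ^ 2 - 1 : Polynomial ℝ) ^ l)).eval x = 0 := by
  obtain ⟨r, hr⟩ := Polynomial.pow_sub_dvd_iterate_derivative_pow
    (Polynomial.X ^ 2 - 1 : Polynomial ℝ) l j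
  rw [hr]
  simp [hx, Nat.sub_ne_zero_of_lt h]

/-- Integration by parts `k` times; the boundary terms vanish because `±1` are zeros of order `l` of
`(X² - 1)ˡ`. -/
theorem integral_mul_iterate_derivative (l : ℕ) (f : Polynomial ℝ) {k : ℕ} (hk : k ≤ l) :
    ∫ y in (-1 : ℝ)..1, f.eval y *
        (Polynomial.derivative^[k] ((Polynomial.X ^ 2 - 1 : Polynomial ℝ) ^ l)).eval y
      = (-1) ^ k * ∫ y in (-1 : ℝ)..1, (Polynomial.derivative^[k] f).eval y * (y ^ 2 - 1) ^ l := by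
  induction k generalizing f with
  | zero => simp
  | succ k ih =>
    have hz {x : ℝ} (hx : x ^ 2 = 1) := eval_iterate_derivative_sq_sub_one hk hx
    simp only [Function.iterate_succ_apply']
    rw [intervalIntegral.integral_mul_deriv_eq_deriv_mul
      (u := fun y => f.eval y) (u' := fun y => f.derivative.eval y)
      (fun x _ => f.hasDerivAt x) (fun x _ => Polynomial.hasDerivAt _ x)
      ((Polynomial.continuous _).intervalIntegrable _ _)
      ((Polynomial.continuous _).intervalIntegrable _ _),
      hz (by norm_num), hz (by norm_num), ih _ (Nat.le_of_succ_le hk)]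
    simp only [← Function.iterate_succ_apply, ← Function.iterate_succ_apply']
    ring

/-- Rodrigues' formula and `l` integrations by parts. For `n < l` the falling factorial is zero, so
the truncated `n - l` does no harm. -/
theorem legendreMoment_eq (l n : ℕ) :
    legendreMoment l n = n.descFactorial l / (2 ^ l * l.factorial) * betaMoment (n - l) l := by
  have h := integral_mul_iterate_derivative l (Polynomial.X ^ n) le_rfl
  have h1 : legendreMoment l n = 1 / (2 ^ l * (l.factorial : ℝ)) * ∫ y in (-1 : ℝ)..1,
      (Polynomial.X ^ n : Polynomial ℝ).eval y *
        (Polynomial.derivative^[l] ((Polynomial.X ^ 2 - 1 : Polynomial ℝ) ^ l)).eval y := by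
    rw [legendreMoment, ← intervalIntegral.integral_const_mul]
    congr 1 with y
    simp only [legendreP, Polynomial.eval_mul, Polynomial.eval_C, Polynomial.eval_pow,
      Polynomial.eval_X]
    ring
  have h2 : ((-1 : ℝ)) ^ l * ∫ y in (-1 : ℝ)..1,
      (Polynomial.derivative^[l] (Polynomial.X ^ n : Polynomial ℝ)).eval y * (y ^ 2 - 1) ^ l
      = n.descFactorial l * betaMoment (n - l) l := by
    rw [betaMoment, ← intervalIntegral.integral_const_mul, ← intervalIntegral.integral_const_mul]
    congr 1 with y
    rw [Polynomial.iterate_derivative_X_pow_eq_natCast_mul,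
      show (1 - y ^ 2) = (-1) * (y ^ 2 - 1) by ring, mul_pow (-1 : ℝ)]
    simp only [Polynomial.eval_mul, Polynomial.eval_natCast, Polynomial.eval_pow,
      Polynomial.eval_X]
    ring
  rw [h1, h, h2]
  ring

theorem betaMoment_succ (m l : ℕ) :
    betaMoment m (l + 1) = betaMoment m l - betaMoment (m + 2) l := by
  rw [betaMoment, betaMoment, betaMoment, ← intervalIntegral.integral_sub]
  · congr 1 with y; ring
  all_goals exact (by fun_prop : Continuous _).intervalIntegrable _ _

/-- The derivative of `yᵐ⁺¹ (1 - y²)ˡ⁺¹` integrates to zero over `[-1, 1]`. -/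
theorem betaMoment_add_two (m l : ℕ) :
    (m + 2 * l + 3) * betaMoment (m + 2) l = (m + 1) * betaMoment m l := by
  have h : (m + 1) * betaMoment m (l + 1) - 2 * (l + 1) * betaMoment (m + 2) l = 0 := by
    have := intervalIntegral.integral_eq_sub_of_hasDerivAt (a := -1) (b := 1)
      (f := fun y : ℝ => y ^ (m + 1) * (1 - y ^ 2) ^ (l + 1))
      (f' := fun y => (m + 1) * (y ^ m * (1 - y ^ 2) ^ (l + 1))
        - 2 * (l + 1) * (y ^ (m + 2) * (1 - y ^ 2) ^ l)) (fun x _ => ?_)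
      ((by fun_prop : Continuous _).intervalIntegrable _ _)
    · rw [intervalIntegral.integral_sub, intervalIntegral.integral_const_mul,
        intervalIntegral.integral_const_mul] at this
      · simpa [betaMoment] using this
      all_goals exact (by fun_prop : Continuous _).intervalIntegrable _ _
    · have h1 : HasDerivAt (fun q : ℝ => 1 - q ^ 2) (-(2 * x)) x := by
        simpa using (hasDerivAt_pow 2 x).const_sub 1
      refine ((hasDerivAt_pow (m + 1) x).fun_mul (h1.fun_pow (l + 1))).congr_deriv ?_
      simp only [Nat.add_sub_cancel]
      push_cast
      ring
  rw [betaMoment_succ] at h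
  linear_combination -h

theorem betaMoment_nonneg {m : ℕ} (hm : Even m) (l : ℕ) : 0 ≤ betaMoment m l := by
  refine intervalIntegral.integral_nonneg (by norm_num) fun y hy => ?_
  exact mul_nonneg (hm.pow_nonneg y) (pow_nonneg (by nlinarith [hy.1, hy.2]) _)

theorem betaMoment_odd {m : ℕ} (hm : Odd m) (l : ℕ) : betaMoment m l = 0 := by
  have h := intervalIntegral.integral_comp_neg (a := -1) (b := 1)
    (fun y : ℝ => y ^ m * (1 - y ^ 2) ^ l)
  simp only [hm.neg_pow, even_two.neg_pow, neg_mul, intervalIntegral.integral_neg, neg_neg] at h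
  change -betaMoment m l = betaMoment m l at h
  linarith

theorem legendreMoment_nonneg {l n : ℕ} (h : Even (l + n)) : 0 ≤ legendreMoment l n := by
  rw [legendreMoment_eq]
  rcases lt_or_ge n l with hn | hn
  · simp [Nat.descFactorial_of_lt hn]
  · have : Even (n - l) := by grind
    have := betaMoment_nonneg this l
    positivity

theorem legendreMoment_odd {l n : ℕ} (h : Odd (l + n)) : legendreMoment l n = 0 := by
  rw [legendreMoment_eq]
  rcases lt_or_ge n l with hn | hn
  · simp [Nat.descFactorial_of_lt hn]
  · rw [betaMoment_odd (by grind), mul_zero]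

theorem legendreMoment_add (l m : ℕ) :
    m.factorial * (2 ^ l * l.factorial) * legendreMoment l (l + m)
      = (l + m).factorial * betaMoment m l := by
  have h : (m.factorial : ℝ) * (l + m).descFactorial l = (l + m).factorial := by
    exact_mod_cast (by simpa using Nat.factorial_mul_descFactorial (Nat.le_add_right l m))
  rw [legendreMoment_eq, Nat.add_sub_cancel_left, ← h]
  field_simp

theorem legendreMoment_zero {n : ℕ} (hn : Even n) : legendreMoment 0 n = 2 / (n + 1) := by
  rw [legendreMoment_eq]
  simp [betaMoment, integral_pow, hn.add_one.neg_pow]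
  norm_num

/-- Monotonicity of `(n+1) mₙ`, one of the two inputs of the Chebyshev argument. With `n = l + m`
the ratio of consecutive moments is explicit, and the claim reduces to `(m+2)(m+2l+3) ≤
(l+m+2)(l+m+3)`, whose sides differ by `l(l+1)`. -/
theorem legendreMoment_step {l n : ℕ} (h : Even (l + n)) :
    (n + 1) * legendreMoment l n ≤ (n + 3) * legendreMoment l (n + 2) := by
  rcases lt_or_ge n l with hn | hn
  · rw [legendreMoment_eq l n, Nat.descFactorial_of_lt hn]
    have := legendreMoment_nonneg (l := l) (n := n + 2) (by grind)
    simp; positivity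
  obtain ⟨m, rfl⟩ := Nat.exists_eq_add_of_le hn
  have h0 := legendreMoment_nonneg (l := l) (n := l + m + 2) (by grind)
  have h1 := legendreMoment_add l m
  have h2 := legendreMoment_add l (m + 2)
  have h3 := betaMoment_add_two m l
  rw [← add_assoc] at h2
  simp only [Nat.factorial_succ] at h2
  have hm : (0 : ℝ) < m.factorial * (2 ^ l * l.factorial) := by positivity
  have key : (l + m + 2) * ((l + m + 1) * legendreMoment l (l + m))
      = (m + 2) * (m + 2 * l + 3) * legendreMoment l (l + m + 2) := by
    refine mul_left_cancel₀ hm.ne' ?_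
    refine mul_left_cancel₀ (by positivity : (m + 1 : ℝ) ≠ 0) ?_
    push_cast at h2
    linear_combination (m + 1) * (l + m + 2) * (l + m + 1 : ℝ) * h1
      - (m + 2 * l + 3) * h2 - (l + m + 2) * (l + m + 1) * ((l + m).factorial : ℝ) * h3
  have hpos : (0 : ℝ) < l + m + 2 := by positivity
  push_cast
  refine le_of_mul_le_mul_left ?_ hpos
  rw [key, ← mul_assoc]
  refine mul_le_mul_of_nonneg_right ?_ h0
  have hl : (0 : ℝ) ≤ l := by positivity
  nlinarith

/-- For `n = l + 2 + m` the quotient of the two moments is `(m+2)/(m+2l+5) ≤ 1`. This makes degree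
zero the worst case among even degrees. -/
theorem legendreMoment_add_two_le {l n : ℕ} (h : Even (l + n)) :
    legendreMoment (l + 2) n ≤ legendreMoment l n := by
  have h0 := legendreMoment_nonneg h
  rcases lt_or_ge n (l + 2) with hn | hn
  · rw [legendreMoment_eq (l + 2) n, Nat.descFactorial_of_lt hn]
    simpa using h0
  obtain ⟨m, rfl⟩ := Nat.exists_eq_add_of_le hn
  have h1 := legendreMoment_add (l + 2) m
  have h2 := legendreMoment_add l (m + 2)
  have e := betaMoment_succ m (l + 1)
  have e1 := betaMoment_succ m l
  have e2 := betaMoment_succ (m + 2) l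
  have e3 := betaMoment_add_two m l
  have e4 := betaMoment_add_two (m + 2) l
  rw [show l + (m + 2) = l + 2 + m by ring] at h2
  have key : (m + 2 * l + 5) * legendreMoment (l + 2) (l + 2 + m)
      = (m + 2) * legendreMoment l (l + 2 + m) := by
    have hb : (m + 1) * (m + 2 * l + 5) * betaMoment m (l + 2)
        = 4 * (l + 1) * (l + 2) * betaMoment (m + 2) l := by
      push_cast at e4
      linear_combination (m + 1) * (m + 2 * l + 5 : ℝ) * (e + e1 - e2)
        - (m + 2 * l + 5 : ℝ) * e3 + (m + 1 : ℝ) * e4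
    have hm : (0 : ℝ) < m.factorial * (2 ^ l * l.factorial) * (4 * (l + 1) * (l + 2)) := by
      positivity
    refine mul_left_cancel₀ hm.ne' ?_
    refine mul_left_cancel₀ (by positivity : (m + 1 : ℝ) ≠ 0) ?_
    simp only [Nat.factorial_succ, pow_succ] at h1 h2
    push_cast at h1 h2
    linear_combination (m + 1) * (m + 2 * l + 5 : ℝ) * h1 - 4 * (l + 1) * (l + 2 : ℝ) * h2
      + ((l + 2 + m).factorial : ℝ) * hb
  have hpos : (0 : ℝ) < m + 2 * l + 5 := by positivity
  refine le_of_mul_le_mul_left ?_ hpos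
  rw [key]
  refine mul_le_mul_of_nonneg_right ?_ h0
  have hl : (0 : ℝ) ≤ l := by positivity
  linarith

theorem legendreMoment_le {l n : ℕ} (hl : Even l) (hn : Even n) :
    legendreMoment l n ≤ 2 / (n + 1) := by
  obtain ⟨i, rfl⟩ := hl
  induction i with
  | zero => exact (legendreMoment_zero hn).le
  | succ i ih =>
    rw [show i + 1 + (i + 1) = i + i + 2 by ring]
    exact (legendreMoment_add_two_le (by grind)).trans ih

/-! ### The Chebyshev type inequality. -/

theorem powMass_even_pos (k : ℕ) : 0 < powMass (2 * k) := by
  induction k with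
  | zero => rw [mul_zero, powMass_zero]; positivity
  | succ k ih =>
    have h := powMass_add_two (2 * k)
    have : (0 : ℝ) < ((2 * k : ℕ) + 2) * powMass (2 * k + 2) := by rw [h]; positivity
    exact pos_of_mul_pos_right this (by positivity)

/-- A Chebyshev type inequality: if the signs of `d` change from negative to nonnegative,
then weighting the series `∑ wₖ dₖ` by a monotone sequence does not make it negative. -/
theorem nonneg_of_hasSum_of_monotone {w d u : ℕ → ℝ} {A B : ℝ} (hw : ∀ k, 0 ≤ w k)
    (hu : Monotone u) (hu0 : 0 ≤ u 0) (hd : Monotone d) (hK : ∃ k, 0 ≤ d k) (hA : 0 ≤ A)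
    (hsum : HasSum (fun k => w k * d k) A) (hsum' : HasSum (fun k => w k * d k * u k) B) :
    0 ≤ B := by
  classical
  -- `K` is the index of the sign change. On either side of it `wₖ dₖ uₖ ≥ wₖ dₖ u_K`, so the
  -- weighted sum is at least `u_K * A`.
  set K := Nat.find hK
  have h0 : 0 ≤ u K * A := mul_nonneg (hu0.trans (hu K.zero_le)) hA
  refine h0.trans (hasSum_le (fun k => ?_) (hsum.mul_left (u K)) hsum')
  rcases lt_or_ge k K with hk | hk
  · have h1 : w k * d k ≤ 0 :=
      mul_nonpos_of_nonneg_of_nonpos (hw k) (not_le.1 (Nat.find_min hK hk)).le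
    nlinarith [hu hk.le]
  · have h1 : 0 ≤ w k * d k := mul_nonneg (hw k) ((Nat.find_spec hK).trans (hd hk))
    nlinarith [hu hk]

/-! ### Schur bounds for the homogeneous forms. -/

/-- The quadratic form of the homogeneous kernel `(2pq)ⁿ / (p² + q²)ⁿ⁺¹`. -/
noncomputable def powForm (n : ℕ) (f : ℝ → ℂ) : ℂ :=
  ∫ x, starRingEnd ℂ (f x.1) * f x.2 * (powKernel n x.1 x.2 : ℂ) ∂halfLine.prod halfLine

instance : SFinite halfLine := by unfold halfLine; infer_instance

theorem ae_prod_halfLine_pos : ∀ᵐ x ∂halfLine.prod halfLine, 0 < x.1 ∧ 0 < x.2 :=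
  (Measure.quasiMeasurePreserving_fst.ae ae_halfLine_pos).and
    (Measure.quasiMeasurePreserving_snd.ae ae_halfLine_pos)

theorem integrable_sq_mul_powKernel {f : ℝ → ℂ} (hf : AEStronglyMeasurable f halfLine)
    (hE : Integrable (fun p => ‖f p‖ ^ 2 / p) halfLine) (n : ℕ) :
    Integrable (fun x : ℝ × ℝ => ‖f x.1‖ ^ 2 * powKernel n x.1 x.2) (halfLine.prod halfLine) := by
  have hm : AEStronglyMeasurable (fun x : ℝ × ℝ => ‖f x.1‖ ^ 2 * powKernel n x.1 x.2)
      (halfLine.prod halfLine) :=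
    (hf.comp_fst.norm.pow 2).mul (measurable_powKernel n).aestronglyMeasurable
  rw [integrable_prod_iff hm]
  constructor
  · filter_upwards [ae_halfLine_pos] with p hp using (integrable_powKernel n hp).const_mul _
  · refine (hE.const_mul (powMass n)).congr ?_
    filter_upwards [ae_halfLine_pos] with p hp
    have : ∫ q, ‖‖f p‖ ^ 2 * powKernel n p q‖ ∂halfLine
        = ∫ q, ‖f p‖ ^ 2 * powKernel n p q ∂halfLine := by
      refine integral_congr_ae ?_
      filter_upwards [ae_halfLine_pos] with q hq
      exact Real.norm_of_nonneg (mul_nonneg (by positivity) (powKernel_nonneg n hp.le hq.le))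
    simp only [this]
    rw [integral_const_mul, integral_powKernel n hp]
    ring

theorem integral_sq_mul_powKernel {f : ℝ → ℂ} (hf : AEStronglyMeasurable f halfLine)
    (hE : Integrable (fun p => ‖f p‖ ^ 2 / p) halfLine) (n : ℕ) :
    ∫ x, ‖f x.1‖ ^ 2 * powKernel n x.1 x.2 ∂halfLine.prod halfLine
      = powMass n * ∫ p, ‖f p‖ ^ 2 / p ∂halfLine := by
  rw [integral_prod _ (integrable_sq_mul_powKernel hf hE n), ← integral_const_mul]
  refine integral_congr_ae ?_
  filter_upwards [ae_halfLine_pos] with p hp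
  rw [integral_const_mul, integral_powKernel n hp]
  ring

theorem integrable_half_sq_mul_powKernel {f : ℝ → ℂ} (hf : AEStronglyMeasurable f halfLine)
    (hE : Integrable (fun p => ‖f p‖ ^ 2 / p) halfLine) (n : ℕ) :
    Integrable (fun x : ℝ × ℝ => (‖f x.1‖ ^ 2 * powKernel n x.1 x.2
      + ‖f x.2‖ ^ 2 * powKernel n x.2 x.1) / 2) (halfLine.prod halfLine) :=
  have h := integrable_sq_mul_powKernel hf hE n
  (h.add h.swap).div_const 2

theorem mul_mul_powKernel_le (f : ℝ → ℂ) (n : ℕ) {x : ℝ × ℝ} (hx : 0 < x.1 ∧ 0 < x.2) :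
    ‖f x.1‖ * ‖f x.2‖ * powKernel n x.1 x.2 ≤ (‖f x.1‖ ^ 2 * powKernel n x.1 x.2
      + ‖f x.2‖ ^ 2 * powKernel n x.2 x.1) / 2 := by
  rw [powKernel_comm n x.2 x.1]
  have := powKernel_nonneg n hx.1.le hx.2.le
  nlinarith [mul_nonneg this (sq_nonneg (‖f x.1‖ - ‖f x.2‖))]

theorem integrable_mul_powKernel {f : ℝ → ℂ} (hf : AEStronglyMeasurable f halfLine)
    (hE : Integrable (fun p => ‖f p‖ ^ 2 / p) halfLine) (n : ℕ) :
    Integrable (fun x : ℝ × ℝ => ‖f x.1‖ * ‖f x.2‖ * powKernel n x.1 x.2)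
      (halfLine.prod halfLine) := by
  refine (integrable_half_sq_mul_powKernel hf hE n).mono'
    ((hf.comp_fst.norm.mul hf.comp_snd.norm).mul
      (measurable_powKernel n).aestronglyMeasurable) ?_
  filter_upwards [ae_prod_halfLine_pos] with x hx
  have := powKernel_nonneg n hx.1.le hx.2.le
  rw [Real.norm_of_nonneg (by positivity)]
  exact mul_mul_powKernel_le f n hx

/-- Schur test: `2|f(p)||f(q)| ≤ |f(p)|² + |f(q)|²`, the symmetry of the kernel and its row
integrals `wₙ / p`. -/
theorem integral_mul_powKernel_le {f : ℝ → ℂ} (hf : AEStronglyMeasurable f halfLine)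
    (hE : Integrable (fun p => ‖f p‖ ^ 2 / p) halfLine) (n : ℕ) :
    ∫ x, ‖f x.1‖ * ‖f x.2‖ * powKernel n x.1 x.2 ∂halfLine.prod halfLine
      ≤ powMass n * ∫ p, ‖f p‖ ^ 2 / p ∂halfLine := by
  have h := integrable_sq_mul_powKernel hf hE n
  have h' : Integrable (fun x : ℝ × ℝ => ‖f x.2‖ ^ 2 * powKernel n x.2 x.1)
    (halfLine.prod halfLine) := h.swap
  calc _ ≤ ∫ x, (‖f x.1‖ ^ 2 * powKernel n x.1 x.2
      + ‖f x.2‖ ^ 2 * powKernel n x.2 x.1) / 2 ∂halfLine.prod halfLine := by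
        refine integral_mono_ae (integrable_mul_powKernel hf hE n)
          (integrable_half_sq_mul_powKernel hf hE n) ?_
        filter_upwards [ae_prod_halfLine_pos] with x hx using mul_mul_powKernel_le f n hx
    _ = _ := by
        have hs := integral_prod_swap (μ := halfLine) (ν := halfLine)
          (fun x : ℝ × ℝ => ‖f x.1‖ ^ 2 * powKernel n x.1 x.2)
        simp only [Prod.fst_swap, Prod.snd_swap] at hs
        rw [integral_div, integral_add h h', hs, integral_sq_mul_powKernel hf hE n]
        ring

theorem integrable_powForm {f : ℝ → ℂ} (hf : AEStronglyMeasurable f halfLine)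
    (hE : Integrable (fun p => ‖f p‖ ^ 2 / p) halfLine) (n : ℕ) :
    Integrable (fun x : ℝ × ℝ => starRingEnd ℂ (f x.1) * f x.2 * (powKernel n x.1 x.2 : ℂ))
      (halfLine.prod halfLine) := by
  refine (integrable_mul_powKernel hf hE n).mono
    (((Complex.continuous_conj.comp_aestronglyMeasurable hf.comp_fst).mul hf.comp_snd).mul
      (Complex.measurable_ofReal.comp (measurable_powKernel n)).aestronglyMeasurable) ?_
  exact ae_of_all _ fun x => by simp

theorem norm_powForm_le {f : ℝ → ℂ} (hf : AEStronglyMeasurable f halfLine)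
    (hE : Integrable (fun p => ‖f p‖ ^ 2 / p) halfLine) (n : ℕ) :
    ‖powForm n f‖ ≤ powMass n * ∫ p, ‖f p‖ ^ 2 / p ∂halfLine := by
  refine (norm_integral_le_integral_norm _).trans
    (le_trans (le_of_eq ?_) (integral_mul_powKernel_le hf hE n))
  refine integral_congr_ae ?_
  filter_upwards [ae_prod_halfLine_pos] with x hx
  simp [abs_of_nonneg (powKernel_nonneg n hx.1.le hx.2.le)]

/-! ### Positivity and monotonicity of the homogeneous forms. -/

theorem integrable_pow_mul_exp (n : ℕ) {r : ℝ} (hr : 0 < r) :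
    Integrable (fun t : ℝ => t ^ n * Real.exp (-(r * t))) halfLine := by
  have h := integrableOn_rpow_mul_exp_neg_mul_rpow (p := 1) (s := n) (b := r)
    (by have := n.cast_nonneg (α := ℝ); linarith) one_pos hr
  simpa [halfLine, IntegrableOn] using h

theorem integral_pow_mul_exp (n : ℕ) {r : ℝ} (hr : 0 < r) :
    ∫ t, t ^ n * Real.exp (-(r * t)) ∂halfLine = n.factorial / r ^ (n + 1) := by
  have h := Real.integral_rpow_mul_exp_neg_mul_Ioi (a := n + 1) (r := r) (by positivity) hr
  rw [Real.Gamma_nat_eq_factorial] at h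
  rw [show (n : ℝ) + 1 = (n + 1 : ℕ) by push_cast; rfl, Real.rpow_natCast] at h
  simp only [Nat.cast_add_one, add_sub_cancel_right, Real.rpow_natCast] at h
  rw [halfLine]
  rw [h, one_div, inv_pow]
  ring

/-- A kernel that is a superposition of products with nonnegative weights has a nonnegative form. -/
theorem exists_nonneg_eq_integral_form {f : ℝ → ℂ} (hf : AEStronglyMeasurable f halfLine)
    (hE : Integrable (fun p => ‖f p‖ ^ 2 / p) halfLine) (n : ℕ) {g : ℝ → ℝ} (hg : Continuous g)
    {C : ℝ} (hC : ∀ x, 0 ≤ x → |g x| ≤ C * Real.exp (-(x / 2))) :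
    ∃ r : ℝ, 0 ≤ r ∧ ∫ x : ℝ × ℝ, starRingEnd ℂ (f x.1) * f x.2 *
      ((∫ t, t ^ n * ((x.1 ^ n * g (t * x.1 ^ 2)) * (x.2 ^ n * g (t * x.2 ^ 2))) ∂halfLine : ℝ) : ℂ)
        ∂halfLine.prod halfLine = r := by
  have hC0 : 0 ≤ C := by simpa using (abs_nonneg _).trans (hC 0 le_rfl)
  -- Majorant for Fubini: `|g x| ≤ C e^(-x/2)` is used in both factors, and the integral of `B` over
  -- `t` is `2 C² n!` times `|f(p)||f(q)|` times the homogeneous kernel.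
  set B : (ℝ × ℝ) × ℝ → ℝ := fun z => C ^ 2 * (‖f z.1.1‖ * ‖f z.1.2‖ * (z.1.1 * z.1.2) ^ n) *
    (z.2 ^ n * Real.exp (-((z.1.1 ^ 2 + z.1.2 ^ 2) / 2 * z.2))) with hBdef
  have hfm : AEStronglyMeasurable (fun x : ℝ × ℝ => f x.1) (halfLine.prod halfLine) := hf.comp_fst
  have hfm' : AEStronglyMeasurable (fun x : ℝ × ℝ => f x.2) (halfLine.prod halfLine) := hf.comp_snd
  have hm1 : AEStronglyMeasurable (fun z : (ℝ × ℝ) × ℝ => f z.1.1)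
    ((halfLine.prod halfLine).prod halfLine) := hfm.comp_fst
  have hm2 : AEStronglyMeasurable (fun z : (ℝ × ℝ) × ℝ => f z.1.2)
    ((halfLine.prod halfLine).prod halfLine) := hfm'.comp_fst
  have hpos : ∀ᵐ z ∂(halfLine.prod halfLine).prod halfLine, (0 < z.1.1 ∧ 0 < z.1.2) ∧ 0 < z.2 :=
    (Measure.quasiMeasurePreserving_fst.ae ae_prod_halfLine_pos).and
      (Measure.quasiMeasurePreserving_snd.ae ae_halfLine_pos)
  have hB : Integrable B ((halfLine.prod halfLine).prod halfLine) := by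
    have hBm : AEStronglyMeasurable B ((halfLine.prod halfLine).prod halfLine) := by
      refine (((hm1.norm.mul hm2.norm).mul ?_).const_mul _).mul ?_ <;>
      exact (by fun_prop : Measurable _).aestronglyMeasurable
    rw [integrable_prod_iff hBm]
    constructor
    · filter_upwards [ae_prod_halfLine_pos] with x hx
      have h1 := hx.1
      have h2 := hx.2
      have hA : 0 < (x.1 ^ 2 + x.2 ^ 2) / 2 := by positivity
      exact (integrable_pow_mul_exp n hA).const_mul (C ^ 2 * (‖f x.1‖ * ‖f x.2‖ * (x.1 * x.2) ^ n))
    · refine ((integrable_mul_powKernel hf hE n).const_mul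
        (2 * C ^ 2 * n.factorial)).congr ?_
      filter_upwards [ae_prod_halfLine_pos] with x hx
      have h1 := hx.1
      have h2 := hx.2
      have : ∫ t, ‖B (x, t)‖ ∂halfLine = ∫ t, B (x, t) ∂halfLine := by
        refine integral_congr_ae ?_
        filter_upwards [ae_halfLine_pos] with t ht
        exact Real.norm_of_nonneg (by simp only [hBdef]; positivity)
      rw [this, hBdef]
      simp only
      rw [integral_const_mul, integral_pow_mul_exp n (by positivity), powKernel, div_pow,
        show 2 * x.1 * x.2 = 2 * (x.1 * x.2) by ring, mul_pow 2]
      field_simp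
      ring
  set H : ℝ × ℝ → ℝ → ℂ := fun x t => starRingEnd ℂ (f x.1) * f x.2 *
    ((t ^ n * ((x.1 ^ n * g (t * x.1 ^ 2)) * (x.2 ^ n * g (t * x.2 ^ 2))) : ℝ) : ℂ) with hHdef
  have hH : Integrable (Function.uncurry H) ((halfLine.prod halfLine).prod halfLine) := by
    refine hB.mono' ?_ ?_
    · refine ((Complex.continuous_conj.comp_aestronglyMeasurable hm1).mul hm2).mul ?_
      have hgm := hg.measurable
      exact (by fun_prop : Measurable _).aestronglyMeasurable
    · filter_upwards [hpos] with z hz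
      obtain ⟨⟨h1, h2⟩, h3⟩ := hz
      simp only [Function.uncurry, hHdef, hBdef, norm_mul, RCLike.norm_conj, Complex.norm_real,
        norm_pow, Real.norm_eq_abs, abs_of_pos h1, abs_of_pos h2, abs_of_pos h3]
      have e : Real.exp (-((z.1.1 ^ 2 + z.1.2 ^ 2) / 2 * z.2))
          = Real.exp (-(z.2 * z.1.1 ^ 2 / 2)) * Real.exp (-(z.2 * z.1.2 ^ 2 / 2)) := by
        rw [← Real.exp_add]; congr 1; ring
      rw [e]
      calc _ ≤ ‖f z.1.1‖ * ‖f z.1.2‖ * (z.2 ^ n *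
            (z.1.1 ^ n * (C * Real.exp (-(z.2 * z.1.1 ^ 2 / 2))) *
            (z.1.2 ^ n * (C * Real.exp (-(z.2 * z.1.2 ^ 2 / 2)))))) := by
            gcongr
            · exact hC _ (by positivity)
            · exact hC _ (by positivity)
        _ = _ := by rw [mul_pow z.1.1]; ring
  -- Once `t` is integrated last, the `p` and `q` integrals factor into a complex number and its
  -- conjugate.
  refine ⟨∫ t, t ^ n * ‖∫ q, f q * ((q ^ n * g (t * q ^ 2) : ℝ) : ℂ) ∂halfLine‖ ^ 2 ∂halfLine,
    integral_nonneg_of_ae ?_, ?_⟩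
  · filter_upwards [ae_halfLine_pos] with t ht
    have := ht.le
    simp only [Pi.zero_apply]; positivity
  · have h1 : ∀ x : ℝ × ℝ, starRingEnd ℂ (f x.1) * f x.2 *
        ((∫ t, t ^ n * ((x.1 ^ n * g (t * x.1 ^ 2)) * (x.2 ^ n * g (t * x.2 ^ 2))) ∂halfLine : ℝ)
          : ℂ) = ∫ t, H x t ∂halfLine := fun x => by
      rw [← integral_complex_ofReal, ← integral_const_mul]
    simp_rw [h1]
    rw [integral_integral_swap hH, ← integral_complex_ofReal]
    congr 1 with t
    have h2 : ∀ x : ℝ × ℝ, H x t = (t : ℂ) ^ n *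
        (starRingEnd ℂ (f x.1 * ((x.1 ^ n * g (t * x.1 ^ 2) : ℝ) : ℂ)) *
          (f x.2 * ((x.2 ^ n * g (t * x.2 ^ 2) : ℝ) : ℂ))) := fun x => by
      simp only [hHdef, map_mul, Complex.conj_ofReal]; push_cast; ring
    simp_rw [h2]
    rw [integral_const_mul, integral_prod_mul
      (fun p => starRingEnd ℂ (f p * ((p ^ n * g (t * p ^ 2) : ℝ) : ℂ)))
      (fun q => f q * ((q ^ n * g (t * q ^ 2) : ℝ) : ℂ)), integral_conj, RCLike.conj_mul]
    push_cast
    rfl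

theorem integral_pow_mul_gaussian_mul (n : ℕ) {p q : ℝ} (hp : 0 < p) (hq : 0 < q) :
    ∫ t, t ^ n * ((p ^ n * Real.exp (-(t * p ^ 2))) * (q ^ n * Real.exp (-(t * q ^ 2)))) ∂halfLine
      = n.factorial / 2 ^ n * powKernel n p q := by
  have hA : 0 < p ^ 2 + q ^ 2 := by positivity
  have h : ∀ t : ℝ, t ^ n * ((p ^ n * Real.exp (-(t * p ^ 2))) * (q ^ n * Real.exp (-(t * q ^ 2))))
      = (p * q) ^ n * (t ^ n * Real.exp (-((p ^ 2 + q ^ 2) * t))) := fun t => by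
    rw [show -((p ^ 2 + q ^ 2) * t) = -(t * p ^ 2) + -(t * q ^ 2) by ring, Real.exp_add, mul_pow]
    ring
  simp_rw [h]
  rw [integral_const_mul, integral_pow_mul_exp n hA, powKernel, mul_assoc 2, mul_pow 2]
  field_simp

/-- The Gaussian is multiplied by the Laguerre polynomial `L₁⁽ⁿ⁾(2x) = n + 1 - 2x`. Its
superposition is exactly the difference of kernels needed to compare `tₙ₊₂` with `tₙ`. -/
theorem integral_pow_mul_laguerre_mul (n : ℕ) {p q : ℝ} (hp : 0 < p) (hq : 0 < q) :
    ∫ t, t ^ n * ((p ^ n * ((n + 1 - 2 * (t * p ^ 2)) * Real.exp (-(t * p ^ 2)))) *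
      (q ^ n * ((n + 1 - 2 * (t * q ^ 2)) * Real.exp (-(t * q ^ 2))))) ∂halfLine
      = n.factorial / 2 ^ n * (n + 1) *
        ((n + 2) * powKernel (n + 2) p q - (n + 1) * powKernel n p q) := by
  have hA : 0 < p ^ 2 + q ^ 2 := by positivity
  have h : ∀ t : ℝ, t ^ n * ((p ^ n * ((n + 1 - 2 * (t * p ^ 2)) * Real.exp (-(t * p ^ 2)))) *
      (q ^ n * ((n + 1 - 2 * (t * q ^ 2)) * Real.exp (-(t * q ^ 2)))))
      = (p * q) ^ n * (n + 1) ^ 2 * (t ^ n * Real.exp (-((p ^ 2 + q ^ 2) * t)))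
        - (p * q) ^ n * (2 * (n + 1) * (p ^ 2 + q ^ 2)) *
          (t ^ (n + 1) * Real.exp (-((p ^ 2 + q ^ 2) * t)))
        + (p * q) ^ n * (4 * (p * q) ^ 2) *
          (t ^ (n + 2) * Real.exp (-((p ^ 2 + q ^ 2) * t))) := fun t => by
    rw [show -((p ^ 2 + q ^ 2) * t) = -(t * p ^ 2) + -(t * q ^ 2) by ring, Real.exp_add, mul_pow]
    ring
  simp_rw [h]
  have hi := fun m => integrable_pow_mul_exp m hA
  have h1 := (hi n).const_mul ((p * q) ^ n * (n + 1) ^ 2)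
  have h2 := (hi (n + 1)).const_mul ((p * q) ^ n * (2 * (n + 1) * (p ^ 2 + q ^ 2)))
  have h3 := (hi (n + 2)).const_mul ((p * q) ^ n * (4 * (p * q) ^ 2))
  refine (integral_add (h1.sub h2) h3).trans ?_
  rw [integral_sub' h1 h2, integral_const_mul, integral_const_mul,
    integral_const_mul, integral_pow_mul_exp n hA, integral_pow_mul_exp _ hA,
    integral_pow_mul_exp _ hA, powKernel, powKernel, mul_assoc 2 p q, mul_pow 2 (p * q), mul_pow 2 (p * q)]
  simp only [Nat.factorial_succ, pow_succ, mul_pow]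
  push_cast
  field_simp
  ring

theorem exists_powForm_eq {f : ℝ → ℂ} (hf : AEStronglyMeasurable f halfLine)
    (hE : Integrable (fun p => ‖f p‖ ^ 2 / p) halfLine) (n : ℕ) :
    ∃ r : ℝ, 0 ≤ r ∧ powForm n f = r := by
  obtain ⟨r, hr, h⟩ := exists_nonneg_eq_integral_form hf hE n (g := fun x => Real.exp (-x))
    (by fun_prop) (C := 1) (fun x hx => by
      rw [abs_of_pos (Real.exp_pos _), one_mul]
      exact Real.exp_le_exp.2 (by linarith))
  refine ⟨r / (n.factorial / 2 ^ n), by positivity, ?_⟩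
  have hc : ((n.factorial / 2 ^ n : ℝ) : ℂ) ≠ 0 := by
    exact_mod_cast (by positivity : (n.factorial / 2 ^ n : ℝ) ≠ 0)
  rw [Complex.ofReal_div, eq_div_iff hc, ← h, powForm, ← integral_mul_const]
  refine integral_congr_ae ?_
  filter_upwards [ae_prod_halfLine_pos] with x hx
  rw [integral_pow_mul_gaussian_mul n hx.1 hx.2]
  push_cast
  ring

/-- Positivity of the Laguerre superposition. Since the masses satisfy the same relation with
equality, this says that `tₙ / wₙ` does not decrease from `n` to `n + 2` when the masses are
positive. -/
theorem exists_powForm_sub_eq {f : ℝ → ℂ} (hf : AEStronglyMeasurable f halfLine)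
    (hE : Integrable (fun p => ‖f p‖ ^ 2 / p) halfLine) (n : ℕ) :
    ∃ r : ℝ, 0 ≤ r ∧ (n + 2) * powForm (n + 2) f - (n + 1) * powForm n f = r := by
  obtain ⟨r, hr, h⟩ := exists_nonneg_eq_integral_form hf hE n
    (g := fun x => (n + 1 - 2 * x) * Real.exp (-x)) (by fun_prop) (C := n + 5) (fun x hx => by
      have e : Real.exp (-x) = Real.exp (-(x / 2)) * Real.exp (-(x / 2)) := by
        rw [← Real.exp_add]; congr 1; ring
      have h1 : Real.exp (-(x / 2)) ≤ 1 := Real.exp_le_one_iff.2 (by linarith)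
      -- Source of the constant `n + 5`: this bound gives `2x e^(-x/2) ≤ 4`.
      have h2 : x / 2 * Real.exp (-(x / 2)) ≤ 1 := by
        rw [Real.exp_neg, ← div_eq_mul_inv, div_le_one (Real.exp_pos _)]
        linarith [Real.add_one_le_exp (x / 2)]
      have h3 := Real.exp_pos (-(x / 2))
      have h4 : |(n : ℝ) + 1 - 2 * x| ≤ n + 1 + 2 * x := by
        rw [abs_le]; constructor <;> linarith [n.cast_nonneg (α := ℝ)]
      rw [abs_mul, abs_of_pos (Real.exp_pos _), e, ← mul_assoc]
      refine mul_le_mul_of_nonneg_right ?_ h3.le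
      calc _ ≤ (n + 1 + 2 * x) * Real.exp (-(x / 2)) := by gcongr
        _ ≤ _ := by nlinarith [mul_le_mul_of_nonneg_left h1 (by positivity : (0 : ℝ) ≤ n + 1)])
  refine ⟨r / (n.factorial / 2 ^ n * (n + 1)), by positivity, ?_⟩
  have hc : ((n.factorial / 2 ^ n * (n + 1) : ℝ) : ℂ) ≠ 0 := by
    exact_mod_cast (by positivity : (n.factorial / 2 ^ n * (n + 1) : ℝ) ≠ 0)
  rw [Complex.ofReal_div, eq_div_iff hc, ← h, powForm, powForm, ← integral_const_mul,
    ← integral_const_mul, ← integral_sub ((integrable_powForm hf hE _).const_mul _)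
      ((integrable_powForm hf hE _).const_mul _), ← integral_mul_const]
  refine integral_congr_ae ?_
  filter_upwards [ae_prod_halfLine_pos] with x hx
  rw [integral_pow_mul_laguerre_mul n hx.1 hx.2]
  push_cast
  ring

/-! ### Expansion of the kernel forms in homogeneous forms. -/

theorem integrable_of_summable_integral_norm_of_hasSum {α : Type*} [MeasurableSpace α]
    {μ : Measure α} {F : ℕ → α → ℂ} {S : α → ℂ} (hF : ∀ n, Integrable (F n) μ)
    (hs : Summable fun n => ∫ a, ‖F n a‖ ∂μ) (hS : ∀ᵐ a ∂μ, HasSum (fun n => F n a) (S a)) :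
    Integrable S μ ∧ HasSum (fun n => ∫ a, F n a ∂μ) (∫ a, S a ∂μ) := by
  have heq : (fun a => ∑' n, F n a) =ᵐ[μ] S := hS.mono fun a ha => ha.tsum_eq
  refine ⟨⟨?_, ?_⟩, ?_⟩
  · exact aestronglyMeasurable_of_tendsto_ae Filter.atTop
      (fun n => Finset.aestronglyMeasurable_fun_sum (Finset.range n) fun i _ => (hF i).1)
      (hS.mono fun a ha => ha.tendsto_sum_nat)
  · calc ∫⁻ a, ‖S a‖ₑ ∂μ ≤ ∫⁻ a, ∑' n, ‖F n a‖ₑ ∂μ := by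
          refine lintegral_mono_ae (heq.mono fun a ha => ?_)
          rw [← ha]; exact enorm_tsum_le_tsum_enorm
      _ = ∑' n, ENNReal.ofReal (∫ a, ‖F n a‖ ∂μ) := by
          rw [lintegral_tsum fun n => (hF n).1.enorm]
          simp_rw [ofReal_integral_norm_eq_lintegral_enorm (hF _)]
      _ < ⊤ := hs.tsum_ofReal_lt_top
  · rw [← integral_congr_ae heq]
    exact hasSum_integral_of_summable_integral_norm hF hs

theorem integrable_mul_triple {L : Type*} [RCLike L] {I : Measure ℝ} [SFinite I]
    {u : ℝ × ℝ → L} {v : ℝ → L} (hu : Integrable u (halfLine.prod halfLine)) (hv : Integrable v I) :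
    Integrable (fun x : ℝ × ℝ × ℝ => u (x.1, x.2.1) * v x.2.2) (halfLine.prod (halfLine.prod I)) :=
  ((measurePreserving_prodAssoc halfLine halfLine I).integrable_comp_emb
    MeasurableEquiv.prodAssoc.measurableEmbedding).1 (hu.mul_prod hv)

theorem integral_mul_triple {L : Type*} [RCLike L] {I : Measure ℝ} [SFinite I]
    (u : ℝ × ℝ → L) (v : ℝ → L) :
    ∫ x : ℝ × ℝ × ℝ, u (x.1, x.2.1) * v x.2.2 ∂halfLine.prod (halfLine.prod I)
      = (∫ x, u x ∂halfLine.prod halfLine) * ∫ y, v y ∂I := by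
  rw [← integral_prod_mul, ← (measurePreserving_prodAssoc halfLine halfLine I).integral_comp
    MeasurableEquiv.prodAssoc.measurableEmbedding]
  rfl

theorem hasSum_powKernel {p q y b : ℝ} (hp : 0 < p) (hq : 0 < q) (hy : |y| < 1) (hb : |b| ≤ 1) :
    HasSum (fun n => powKernel n p q * (b * y) ^ n) (1 / (p ^ 2 + q ^ 2 - 2 * b * p * q * y)) := by
  have hA : 0 < p ^ 2 + q ^ 2 := by positivity
  have hpq : 2 * p * q ≤ p ^ 2 + q ^ 2 := by nlinarith [sq_nonneg (p - q)]
  set r := 2 * p * q * (b * y) / (p ^ 2 + q ^ 2) with hr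
  have hby : |b * y| < 1 := by
    rw [abs_mul]; exact (mul_le_of_le_one_left (abs_nonneg y) hb).trans_lt hy
  have hr1 : |r| < 1 := by
    rw [hr, abs_div, abs_of_pos hA, div_lt_one hA, abs_mul, abs_of_pos (by positivity)]
    calc _ < 2 * p * q * 1 := by gcongr
      _ ≤ _ := by linarith
  have h := (hasSum_geometric_of_abs_lt_one hr1).mul_left (p ^ 2 + q ^ 2)⁻¹
  have h1 : 1 - r ≠ 0 := by have := (abs_lt.1 hr1).2; linarith
  have h2 : p ^ 2 + q ^ 2 - 2 * b * p * q * y = (p ^ 2 + q ^ 2) * (1 - r) := by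
    rw [hr]; field_simp
  rw [h2, one_div, mul_inv]
  refine h.congr_fun fun n => ?_
  rw [powKernel, hr, div_pow, mul_pow (2 * p * q), pow_succ]
  field_simp

theorem integral_abs_pow (n : ℕ) : ∫ y in Icc (-1 : ℝ) 1, |y| ^ n = 2 / (n + 1) := by
  have h1 : ∫ y in (0 : ℝ)..1, |y| ^ n = 1 / (n + 1) := by
    rw [intervalIntegral.integral_congr (g := fun y => y ^ n) fun y hy => by
      rw [uIcc_of_le zero_le_one] at hy; simp only [abs_of_nonneg hy.1]]
    simp [integral_pow]
  have h2 := intervalIntegral.integral_comp_neg (a := 0) (b := 1) (fun y : ℝ => |y| ^ n)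
  simp only [abs_neg, neg_zero] at h2
  have hi (a b : ℝ) : IntervalIntegrable (fun y : ℝ => |y| ^ n) volume a b :=
    (by fun_prop : Continuous _).intervalIntegrable _ _
  rw [integral_Icc_eq_integral_Ioc, ← intervalIntegral.integral_of_le (by norm_num),
    ← intervalIntegral.integral_add_adjacent_intervals (hi (-1) 0) (hi 0 1), ← h2, h1]
  ring

theorem kernelForm_eq_integral {K : ℝ → ℝ → ℝ → ℝ} {ψ : ℝ → ℂ} (h : KernelFormConverges K ψ) :
    kernelForm K ψ = ∫ x : ℝ × ℝ × ℝ, (x.1 : ℂ) ^ 2 * (x.2.1 : ℂ) ^ 2 *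
      (starRingEnd ℂ (ψ x.1) * ψ x.2.1) * (K x.1 x.2.1 x.2.2 : ℂ)
      ∂halfLine.prod (halfLine.prod (volume.restrict (Icc (-1) 1))) := by
  rw [integral_prod _ h, kernelForm]
  refine integral_congr_ae ?_
  filter_upwards [Integrable.prod_right_ae h] with p hp
  rw [integral_prod _ hp, ← integral_const_mul]
  congr 1 with q
  simp only
  rw [integral_const_mul, integral_complex_ofReal, integral_Icc_eq_integral_Ioc,
    ← intervalIntegral.integral_of_le (by norm_num)]
  ring

/-- The expansion of the forms with kernel `Pₗ(y) / (p² + q² - 2bpqy)` in homogeneous forms. -/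
theorem hasSum_kernelForm {K : ℝ → ℝ → ℝ → ℝ} {b : ℝ} (hb : |b| ≤ 1) (l : ℕ)
    (hK : ∀ p q y, K p q y = (legendreP l).eval y / (p ^ 2 + q ^ 2 - 2 * b * p * q * y))
    {ψ : ℝ → ℂ} (hψ : AEStronglyMeasurable (fun p : ℝ => (p : ℂ) ^ 2 * ψ p) halfLine)
    (hE : Integrable (fun p : ℝ => ‖(p : ℂ) ^ 2 * ψ p‖ ^ 2 / p) halfLine) :
    KernelFormConverges K ψ ∧ HasSum (fun n => ((b ^ n * legendreMoment l n : ℝ) : ℂ) *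
      powForm n fun p : ℝ => (p : ℂ) ^ 2 * ψ p) (kernelForm K ψ) := by
  set f : ℝ → ℂ := fun p : ℝ => (p : ℂ) ^ 2 * ψ p with hf
  set I : Measure ℝ := volume.restrict (Icc (-1) 1) with hI
  set u : ℕ → ℝ × ℝ → ℂ := fun n x => starRingEnd ℂ (f x.1) * f x.2 * (powKernel n x.1 x.2 : ℂ)
  set v : ℕ → ℝ → ℂ := fun n y => (((legendreP l).eval y * (b * y) ^ n : ℝ) : ℂ) with hv
  obtain ⟨C, hC⟩ : ∃ C, ∀ y ∈ Icc (-1 : ℝ) 1, ‖(legendreP l).eval y‖ ≤ C :=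
    isCompact_Icc.exists_bound_of_continuousOn (legendreP l).continuous.continuousOn
  have hu n : Integrable (u n) (halfLine.prod halfLine) := integrable_powForm hψ hE n
  have hvc n : Continuous (v n) := by
    have := (legendreP l).continuous
    fun_prop
  have hvi n : Integrable (v n) I := (hvc n).continuousOn.integrableOn_Icc
  have hvn n : ∫ y, ‖v n y‖ ∂I ≤ C * (2 / (n + 1)) := by
    rw [← integral_abs_pow, ← integral_const_mul]
    refine integral_mono_ae (hvi n).norm
      ((by fun_prop : Continuous fun y : ℝ => C * |y| ^ n).continuousOn.integrableOn_Icc) ?_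
    filter_upwards [ae_restrict_mem measurableSet_Icc] with y hy
    rw [hv]
    simp only [Complex.norm_real, norm_mul, norm_pow]
    rw [Real.norm_eq_abs b, Real.norm_eq_abs y]
    have h1 := hC y hy
    have h0 : 0 ≤ C := (norm_nonneg _).trans h1
    gcongr
    exact mul_le_of_le_one_left (abs_nonneg y) hb
  have hun n : ∫ x, ‖u n x‖ ∂halfLine.prod halfLine ≤ powMass n * ∫ p, ‖f p‖ ^ 2 / p ∂halfLine := by
    refine le_trans (le_of_eq ?_) (integral_mul_powKernel_le hψ hE n)
    refine integral_congr_ae ?_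
    filter_upwards [ae_prod_halfLine_pos] with x hx
    simp [u, abs_of_nonneg (powKernel_nonneg n hx.1.le hx.2.le)]
  have hE0 : 0 ≤ ∫ p, ‖f p‖ ^ 2 / p ∂halfLine := by
    refine integral_nonneg_of_ae ?_
    filter_upwards [ae_halfLine_pos] with p hp
    simp only [Pi.zero_apply]; positivity
  -- The `n`-th term has `L¹` norm at most `wₙ E * 2C/(n+1)`, with `C` a bound for `|Pₗ|` on `[-1,
  -- 1]`.
  have hsum : Summable fun n => ∫ x : ℝ × ℝ × ℝ, ‖u n (x.1, x.2.1) * v n x.2.2‖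
      ∂halfLine.prod (halfLine.prod I) := by
    refine (summable_powMass_div.mul_left (C * ∫ p, ‖f p‖ ^ 2 / p ∂halfLine)).of_nonneg_of_le
      (fun n => by positivity) fun n => ?_
    simp_rw [norm_mul]
    rw [integral_mul_triple (fun x => ‖u n x‖) (fun y => ‖v n y‖)]
    calc _ ≤ (powMass n * ∫ p, ‖f p‖ ^ 2 / p ∂halfLine) * (C * (2 / (n + 1))) :=
          mul_le_mul (hun n) (hvn n) (by positivity) (mul_nonneg (powMass_nonneg n) hE0)
      _ = _ := by ring
  have hpt : ∀ᵐ x : ℝ × ℝ × ℝ ∂halfLine.prod (halfLine.prod I),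
      HasSum (fun n => u n (x.1, x.2.1) * v n x.2.2)
        ((x.1 : ℂ) ^ 2 * (x.2.1 : ℂ) ^ 2 * (starRingEnd ℂ (ψ x.1) * ψ x.2.1) *
          (K x.1 x.2.1 x.2.2 : ℂ)) := by
    -- The endpoints are dropped: for `|b| = 1` and `p = q` the geometric series has ratio `±y`.
    have hy : ∀ᵐ y ∂I, |y| < 1 := by
      rw [hI, ← restrict_Ioo_eq_restrict_Icc]
      filter_upwards [ae_restrict_mem measurableSet_Ioo] with y hy using abs_lt.2 hy
    have h2 : ∀ᵐ z : ℝ × ℝ ∂halfLine.prod I, 0 < z.1 ∧ |z.2| < 1 :=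
      (Measure.quasiMeasurePreserving_fst.ae ae_halfLine_pos).and
        (Measure.quasiMeasurePreserving_snd.ae hy)
    have h1 : ∀ᵐ x : ℝ × ℝ × ℝ ∂halfLine.prod (halfLine.prod I), 0 < x.1 :=
      Measure.quasiMeasurePreserving_fst.ae ae_halfLine_pos
    filter_upwards [h1, Measure.quasiMeasurePreserving_snd.ae h2] with x hx hz
    have h := (Complex.hasSum_ofReal.2 (hasSum_powKernel hx hz.1 hz.2 hb)).mul_left
      (starRingEnd ℂ (f x.1) * f x.2.1 * (((legendreP l).eval x.2.2 : ℝ) : ℂ))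
    have e : (x.1 : ℂ) ^ 2 * (x.2.1 : ℂ) ^ 2 * (starRingEnd ℂ (ψ x.1) * ψ x.2.1) *
        (K x.1 x.2.1 x.2.2 : ℂ) = starRingEnd ℂ (f x.1) * f x.2.1 *
        (((legendreP l).eval x.2.2 : ℝ) : ℂ) *
        ((1 / (x.1 ^ 2 + x.2.1 ^ 2 - 2 * b * x.1 * x.2.1 * x.2.2) : ℝ) : ℂ) := by
      rw [hK, hf]
      simp only [map_mul, map_pow, Complex.conj_ofReal]
      push_cast
      ring
    rw [e]
    refine h.congr_fun fun n => ?_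
    simp only [u, hv]
    push_cast
    ring
  obtain ⟨hS, hS'⟩ := integrable_of_summable_integral_norm_of_hasSum
    (fun n => integrable_mul_triple (hu n) (hvi n)) hsum hpt
  refine ⟨hS, ?_⟩
  rw [kernelForm_eq_integral hS]
  refine hS'.congr_fun fun n => ?_
  rw [integral_mul_triple (u n) (v n), hv, integral_complex_ofReal, integral_Icc_eq_integral_Ioc,
    ← intervalIntegral.integral_of_le (by norm_num), mul_comm, legendreMoment,
    ← intervalIntegral.integral_const_mul]
  congr 3
  congr 1 with y
  ring

/-! ### The form domain and the diagonal form. -/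

theorem integrable_sq_of_memLp {ψ : ℝ → ℂ} (h : MemLp ψ 2 domMeasure) :
    AEStronglyMeasurable ψ halfLine ∧
      Integrable (fun p => p ^ 2 * √(p ^ 2 + 1) * ‖ψ p‖ ^ 2) halfLine := by
  have hm : Measurable fun p : ℝ => ENNReal.ofReal (p ^ 2 * √(p ^ 2 + 1)) := by fun_prop
  constructor
  · refine h.1.mono_ac (withDensity_absolutelyContinuous' hm.aemeasurable ?_)
    filter_upwards [ae_halfLine_pos] with p hp
    rw [ne_eq, ENNReal.ofReal_eq_zero, not_le]
    positivity
  · have h2 := h.integrable_norm_pow two_ne_zero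
    rw [domMeasure, integrable_withDensity_iff hm (ae_of_all _ fun _ => ENNReal.ofReal_lt_top)] at h2
    refine h2.congr (ae_of_all _ fun p => ?_)
    simp only
    rw [ENNReal.toReal_ofReal (by positivity), mul_comm]

/-- The integrand of `E` is `p³ |ψ|²`, which `p ≤ √(p² + 1)` bounds by the density of the form
domain. -/
theorem integrable_weight_of_memLp {ψ : ℝ → ℂ} (h : MemLp ψ 2 domMeasure) :
    AEStronglyMeasurable (fun p : ℝ => (p : ℂ) ^ 2 * ψ p) halfLine ∧
      Integrable (fun p : ℝ => ‖(p : ℂ) ^ 2 * ψ p‖ ^ 2 / p) halfLine := by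
  obtain ⟨h1, h2⟩ := integrable_sq_of_memLp h
  have h3 : AEStronglyMeasurable (fun p : ℝ => (p : ℂ) ^ 2 * ψ p) halfLine :=
    (by fun_prop : Measurable fun p : ℝ => (p : ℂ) ^ 2).aestronglyMeasurable.mul h1
  refine ⟨h3, h2.mono' ?_ ?_⟩
  · exact ((h3.norm.pow 2).aemeasurable.div measurable_id.aemeasurable).aestronglyMeasurable
  · filter_upwards [ae_halfLine_pos] with p hp
    rw [Real.norm_of_nonneg (by positivity), norm_mul, norm_pow, Complex.norm_real,
      Real.norm_of_nonneg hp.le, mul_pow, show (p ^ 2) ^ 2 * ‖ψ p‖ ^ 2 / p = p ^ 2 * p * ‖ψ p‖ ^ 2 by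
        field_simp]
    gcongr
    exact Real.le_sqrt_of_sq_le (by linarith)

theorem redMass_div_modRedMass {M : ℝ} (hM : 0 < M) :
    redMass M / modRedMass M = (√(M * (M + 2)) / (M + 1)) ^ 2 := by
  rw [div_pow, Real.sq_sqrt (by positivity), redMass, modRedMass]
  field_simp

theorem integrable_diagIntegrand {M ζ : ℝ} (hM : 0 < M) (hζ : 0 ≤ ζ) {ψ : ℝ → ℂ}
    (h : MemLp ψ 2 domMeasure) : Integrable (diagIntegrand M ζ ψ) halfLine := by
  obtain ⟨h1, h2⟩ := integrable_sq_of_memLp h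
  have hc : 0 ≤ redMass M / modRedMass M := by rw [redMass_div_modRedMass hM]; positivity
  refine (h2.const_mul √(redMass M / modRedMass M + ζ)).mono' ?_ (ae_of_all _ fun p => ?_)
  · exact (by fun_prop : Measurable fun k : ℝ =>
      k ^ 2 * √(redMass M / modRedMass M * k ^ 2 + ζ)).aestronglyMeasurable.mul (h1.norm.pow 2)
  · rw [diagIntegrand, Real.norm_of_nonneg (by positivity)]
    calc _ ≤ p ^ 2 * (√(redMass M / modRedMass M + ζ) * √(p ^ 2 + 1)) * ‖ψ p‖ ^ 2 := by
          rw [← Real.sqrt_mul (by positivity)]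
          gcongr
          nlinarith [sq_nonneg p, mul_nonneg hζ (sq_nonneg p)]
      _ = _ := by ring

theorem le_Fdiag {M ζ : ℝ} (hM : 0 < M) (hζ : 0 ≤ ζ) {ψ : ℝ → ℂ} (h : MemLp ψ 2 domMeasure) :
    √(M * (M + 2)) / (M + 1) * ∫ p : ℝ, ‖(p : ℂ) ^ 2 * ψ p‖ ^ 2 / p ∂halfLine ≤ Fdiag M ζ ψ := by
  rw [Fdiag, ← integral_const_mul]
  refine integral_mono_ae ((integrable_weight_of_memLp h).2.const_mul _)
    (integrable_diagIntegrand hM hζ h) ?_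
  filter_upwards [ae_halfLine_pos] with p hp
  rw [diagIntegrand, redMass_div_modRedMass hM, norm_mul, norm_pow, Complex.norm_real,
    Real.norm_of_nonneg hp.le]
  have hs : √(M * (M + 2)) / (M + 1) * p ≤ √((√(M * (M + 2)) / (M + 1)) ^ 2 * p ^ 2 + ζ) :=
    Real.le_sqrt_of_sq_le (by rw [mul_pow]; linarith)
  calc _ = p ^ 2 * (√(M * (M + 2)) / (M + 1) * p) * ‖ψ p‖ ^ 2 := by field_simp
    _ ≤ _ := by gcongr

/-! ### Comparison of the off-diagonal and regularizing forms. -/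

/-- The value `(2 / π) arcsin a / a`, at which the form with kernel parameter `-a` and the
regularizing form balance. -/
noncomputable def balance (a : ℝ) : ℝ := 2 / Real.pi * (Real.arcsin a / a)

theorem hasSum_even_of_legendreMoment {l : ℕ} (hl : Even l) {b S : ℝ} {t : ℕ → ℝ}
    (h : HasSum (fun n => b ^ n * legendreMoment l n * t n) S) :
    HasSum (fun k => b ^ (2 * k) * legendreMoment l (2 * k) * t (2 * k)) S := by
  refine ((mul_right_injective₀ (two_ne_zero' ℕ)).hasSum_iff (fun n hn => ?_)).2 h
  have : Odd n := by
    rw [← Nat.not_even_iff_odd]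
    rintro ⟨k, rfl⟩
    exact hn ⟨k, by simp [two_mul]⟩
  rw [legendreMoment_odd (hl.add_odd this)]
  ring

/-- The regularizing form dominates the off-diagonal form for even degrees. -/
theorem le_balance_mul {l : ℕ} (hl : Even l) {a R O : ℝ} (ha : 0 < a) (ha1 : a < 1) {t : ℕ → ℝ}
    (ht0 : ∀ n, 0 ≤ t n) (ht : ∀ n : ℕ, (n + 1) * t n ≤ (n + 2) * t (n + 2))
    (hR : HasSum (fun k => legendreMoment l (2 * k) * t (2 * k)) R)
    (hO : HasSum (fun k => a ^ (2 * k) * legendreMoment l (2 * k) * t (2 * k)) O) :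
    O ≤ balance a * R := by
  have hc0 (k : ℕ) : 0 ≤ legendreMoment l (2 * k) := legendreMoment_nonneg (by grind)
  have hb : 0 < balance a := by
    have := Real.arcsin_pos.2 ha
    rw [balance]; positivity
  -- The weight is the quotient of the actual terms by the reference terms `wₙ * 2/(n+1)`, for `n =
  -- 2k`. It is a product of two nonnegative nondecreasing factors.
  have hu : Monotone fun k : ℕ => legendreMoment l (2 * k) * ((2 * k + 1) / 2) *
      (t (2 * k) / powMass (2 * k)) := by
    refine monotone_nat_of_le_succ fun k => ?_
    have h1 := legendreMoment_step (l := l) (n := 2 * k) (by grind)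
    have h2 := ht (2 * k)
    have h3 := powMass_add_two (2 * k)
    have hm := powMass_even_pos k
    have hm' := powMass_even_pos (k + 1)
    rw [show 2 * (k + 1) = 2 * k + 2 by ring] at *
    push_cast at *
    refine mul_le_mul (by linarith) ?_ (div_nonneg (ht0 _) hm.le)
      (mul_nonneg (by simpa [mul_add] using hc0 (k + 1)) (by positivity))
    rw [div_le_div_iff₀ hm hm']
    have hk : (0 : ℝ) < 2 * k + 2 := by positivity
    refine le_of_mul_le_mul_left ?_ hk
    calc _ = (2 * k + 1) * t (2 * k) * powMass (2 * k) := by linear_combination t (2 * k) * h3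
      _ ≤ (2 * k + 2) * t (2 * k + 2) * powMass (2 * k) := by gcongr
      _ = _ := by ring
  have hd : Monotone fun k : ℕ => balance a - a ^ (2 * k) := fun i j hij =>
    sub_le_sub_left (pow_le_pow_of_le_one ha.le ha1.le (by omega)) _
  have hK : ∃ k : ℕ, 0 ≤ balance a - a ^ (2 * k) := by
    obtain ⟨n, hn⟩ := exists_pow_lt_of_lt_one hb ha1
    refine ⟨n, sub_nonneg.2 ((pow_le_pow_of_le_one ha.le ha1.le (by omega)).trans hn.le)⟩
  -- `balance a` is chosen so that the reference series cancels: `(π²/2) * balance a = π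
  -- arcsin(a)/a`.
  have hsum : HasSum (fun k : ℕ => powMass (2 * k) * (2 / (2 * k + 1)) *
      (balance a - a ^ (2 * k))) 0 := by
    have h := (hasSum_powMass_even_div.mul_right (balance a)).sub (hasSum_arcsin ha ha1)
    rw [show Real.pi ^ 2 / 2 * balance a - Real.pi * (Real.arcsin a / a) = 0 by
      rw [balance]; field_simp; ring] at h
    exact h.congr_fun fun k => by ring
  have := nonneg_of_hasSum_of_monotone (B := balance a * R - O)
    (fun k => mul_nonneg (powMass_nonneg _) (by positivity)) hu
    (mul_nonneg (mul_nonneg (hc0 0) (by positivity)) (div_nonneg (ht0 _) (powMass_nonneg _)))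
    hd hK le_rfl hsum (((hR.mul_left (balance a)).sub hO).congr_fun fun k => by
      have := (powMass_even_pos k).ne'
      field_simp)
  linarith

theorem regularizing_le {l : ℕ} (hl : Even l) {R E : ℝ} {t : ℕ → ℝ} (ht0 : ∀ n, 0 ≤ t n)
    (htE : ∀ n, t n ≤ powMass n * E)
    (hR : HasSum (fun k => legendreMoment l (2 * k) * t (2 * k)) R) :
    R ≤ Real.pi ^ 2 / 2 * E := by
  refine hasSum_le (fun k => ?_) hR (hasSum_powMass_even_div.mul_right E)
  have h := legendreMoment_le (n := 2 * k) hl (by grind)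
  push_cast at h
  calc _ ≤ 2 / (2 * k + 1) * (powMass (2 * k) * E) :=
        mul_le_mul h (htE _) (ht0 _) (by positivity)
    _ = _ := by ring

/-! ### The critical parameter and the choice of `s`. -/

theorem gammaC_eq (N : ℕ) {M : ℝ} (hM : 0 < M) :
    gammaC N M = balance (1 / (M + 1))
      - 2 * (√(M * (M + 2)) / (M + 1)) / (Real.pi * ((N : ℝ) - 1)) := by
  rw [gammaC, balance]
  congr 1
  · field_simp
  · rw [mul_div_assoc', div_div]; congr 1; ring

/-- `arcsin x ≥ x` makes the first term of `γ_c` at least `2/π`, while `√(M(M+2)) < M+1` and `N - 1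
≥ 1` make the second smaller than `2/π`. The sign of `γ` matters for odd degrees. -/
theorem gammaC_pos {N : ℕ} (hN : 2 ≤ N) {M : ℝ} (hM : 0 < M) : 0 < gammaC N M := by
  have hN1 : (1 : ℝ) ≤ N - 1 := by
    have : (2 : ℝ) ≤ N := by exact_mod_cast hN
    linarith
  have ha : 0 < 1 / (M + 1) := by positivity
  have h1 : 1 ≤ Real.arcsin (1 / (M + 1)) / (1 / (M + 1)) := by
    rw [one_le_div ha]
    have h := Real.sin_le (Real.arcsin_nonneg.2 ha.le)
    rwa [Real.sin_arcsin (by linarith) (by rw [div_le_one] <;> linarith)] at h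
  have h2 : √(M * (M + 2)) / (M + 1) < 1 := by
    rw [div_lt_one (by positivity), Real.sqrt_lt' (by positivity)]; nlinarith
  have h3 : 2 * (√(M * (M + 2)) / (M + 1)) / (Real.pi * ((N : ℝ) - 1)) < 2 / Real.pi := by
    have hpi := Real.pi_pos
    rw [div_lt_div_iff₀ (by positivity) hpi]
    have : 2 * (√(M * (M + 2)) / (M + 1)) * Real.pi < 2 * Real.pi := by nlinarith
    nlinarith
  have h4 : 2 / Real.pi ≤ balance (1 / (M + 1)) :=
    le_mul_of_one_le_right (by positivity) h1
  rw [gammaC_eq N hM]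
  linarith

theorem exists_powForm_seq {f : ℝ → ℂ} (hf : AEStronglyMeasurable f halfLine)
    (hE : Integrable (fun p => ‖f p‖ ^ 2 / p) halfLine) :
    ∃ t : ℕ → ℝ, (∀ n, powForm n f = t n) ∧ (∀ n, 0 ≤ t n) ∧
      (∀ n : ℕ, (n + 1) * t n ≤ (n + 2) * t (n + 2)) ∧
      ∀ n, t n ≤ powMass n * ∫ p, ‖f p‖ ^ 2 / p ∂halfLine := by
  choose t ht0 ht using exists_powForm_eq hf hE
  refine ⟨t, ht, ht0, fun n => ?_, fun n => ?_⟩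
  · obtain ⟨r, hr, h⟩ := exists_powForm_sub_eq hf hE n
    rw [ht, ht] at h
    have : (n + 2) * t (n + 2) - (n + 1) * t n = r := by exact_mod_cast h
    linarith
  · have h := norm_powForm_le hf hE n
    rw [ht, Complex.norm_real, Real.norm_of_nonneg (ht0 n)] at h
    exact h

theorem exists_kernelForm_eq {K : ℝ → ℝ → ℝ → ℝ} {b : ℝ} (hb : |b| ≤ 1) (l : ℕ)
    (hK : ∀ p q y, K p q y = (legendreP l).eval y / (p ^ 2 + q ^ 2 - 2 * b * p * q * y))
    {ψ : ℝ → ℂ} (hψ : MemLp ψ 2 domMeasure) {t : ℕ → ℝ}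
    (ht : ∀ n, powForm n (fun p : ℝ => (p : ℂ) ^ 2 * ψ p) = t n) :
    KernelFormConverges K ψ ∧ ∃ S : ℝ, kernelForm K ψ = S ∧
      HasSum (fun n => b ^ n * legendreMoment l n * t n) S := by
  obtain ⟨h1, h2⟩ := integrable_weight_of_memLp hψ
  obtain ⟨h3, h4⟩ := hasSum_kernelForm hb l hK h1 h2
  simp only [ht, ← Complex.ofReal_mul] at h4
  have h5 := Complex.hasSum_re h4
  simp only [Complex.ofReal_re] at h5
  refine ⟨h3, _, h4.unique ?_, h5⟩
  exact Complex.hasSum_ofReal.2 h5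

theorem balance_coercive {N : ℕ} (hN : 2 ≤ N) {M γ : ℝ} (hM : 0 < M) (hγ : gammaC N M < γ) :
    ∃ s : ℝ, 0 < s ∧ s < 1 ∧ 0 ≤ s * (√(M * (M + 2)) / (M + 1))
      + ((N : ℝ) - 1) / Real.pi * ((γ - balance (1 / (M + 1))) * (Real.pi ^ 2 / 2)) := by
  have hN1 : (0 : ℝ) < N - 1 := by
    have : (2 : ℝ) ≤ N := by exact_mod_cast hN
    linarith
  set D := √(M * (M + 2)) / (M + 1) with hD
  have hD0 : 0 < D := by positivity
  rw [gammaC_eq N hM, ← hD] at hγ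
  set x := (balance (1 / (M + 1)) - γ) * ((N - 1) * Real.pi / 2) with hx
  have hpi := Real.pi_pos
  have hxD : x < D := by
    have h : balance (1 / (M + 1)) - γ < 2 * D / (Real.pi * ((N : ℝ) - 1)) := by linarith
    rw [lt_div_iff₀ (by positivity)] at h
    rw [hx]; linarith
  -- `x / D` is the fraction of the diagonal form that is needed, and `x < D` restates `γ > γ_c`.
  -- The maximum with `1/2` keeps `s` positive when `γ ≥ balance a`.
  refine ⟨max (1 / 2) (x / D), lt_max_of_lt_left (by norm_num),
    max_lt (by norm_num) ((div_lt_one hD0).2 hxD), ?_⟩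
  have h1 : x ≤ max (1 / 2) (x / D) * D := (div_le_iff₀ hD0).1 (le_max_right _ _)
  have h2 : ((N : ℝ) - 1) / Real.pi * ((γ - balance (1 / (M + 1))) * (Real.pi ^ 2 / 2)) = -x := by
    rw [hx]; field_simp; ring
  linarith

/-- The minimum with `0` covers odd degrees and the case `γ ≥ balance a`, where nothing is lost;
otherwise `(γ - balance a) R` is bounded through `R ≤ (π²/2) E`. -/
theorem offDiagonal_le {l : ℕ} {a R O E : ℝ} (ha : 0 < a) (ha1 : a < 1) {t : ℕ → ℝ}
    (ht0 : ∀ n, 0 ≤ t n) (ht : ∀ n : ℕ, (n + 1) * t n ≤ (n + 2) * t (n + 2))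
    (htE : ∀ n, t n ≤ powMass n * E) (hE : 0 ≤ E)
    (hR : HasSum (fun n => 1 ^ n * legendreMoment l n * t n) R)
    (hO : HasSum (fun n => (-a) ^ n * legendreMoment l n * t n) O) {γ : ℝ} (hγ : 0 < γ) :
    min 0 ((γ - balance a) * (Real.pi ^ 2 / 2)) * E ≤ γ * R - O := by
  have hmin : min 0 ((γ - balance a) * (Real.pi ^ 2 / 2)) * E ≤ 0 :=
    mul_nonpos_of_nonpos_of_nonneg (min_le_left _ _) hE
  have hR0 : 0 ≤ R := by
    refine hR.nonneg fun n => ?_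
    rcases Nat.even_or_odd (l + n) with h | h
    · rw [one_pow, one_mul]; exact mul_nonneg (legendreMoment_nonneg h) (ht0 n)
    · simp [legendreMoment_odd h]
  rcases Nat.even_or_odd l with hl | hl
  · have hR' := hasSum_even_of_legendreMoment hl hR
    have hO' := hasSum_even_of_legendreMoment hl hO
    simp only [one_pow, one_mul] at hR'
    simp only [(even_two_mul _).neg_pow] at hO'
    have h1 := le_balance_mul hl ha ha1 ht0 ht hR' hO'
    have h2 := regularizing_le hl ht0 htE hR'
    rcases le_total (balance a) γ with hb | hb
    · have := mul_nonneg (sub_nonneg.2 hb) hR0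
      linarith
    · have h3 := mul_le_mul_of_nonpos_left h2 (sub_nonpos.2 hb)
      have h4 := mul_le_mul_of_nonneg_right
        (min_le_right 0 ((γ - balance a) * (Real.pi ^ 2 / 2))) hE
      linarith
  · have hO0 : O ≤ 0 := by
      refine hO.nonpos fun n => ?_
      rcases Nat.even_or_odd (l + n) with h | h
      · have hn : Odd n := by grind
        rw [hn.neg_pow, neg_mul, neg_mul]
        have := mul_nonneg (mul_nonneg (pow_nonneg ha.le n) (legendreMoment_nonneg h)) (ht0 n)
        linarith
      · simp [legendreMoment_odd h]
    have := mul_nonneg hγ.le hR0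
    linarith

end ImpurityGas

theorem lemma4p3 (N : ℕ) (hN : 2 ≤ N) (M : ℝ) (hM : 0 < M) (γ : ℝ)
    (hγ : ImpurityGas.gammaC N M < γ) :
    ∃ s : ℝ, 0 < s ∧ s < 1 ∧
      ∀ (l : ℕ) (ζ : ℝ), 0 ≤ ζ →
        ∀ ψ : ℝ → ℂ, MeasureTheory.MemLp ψ 2 ImpurityGas.domMeasure →
          ImpurityGas.AuxFormConverges M ζ l ψ ∧
            (ImpurityGas.auxForm N M γ s ζ l ψ).im = 0 ∧
            0 ≤ (ImpurityGas.auxForm N M γ s ζ l ψ).re := by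
  open ImpurityGas in
  have hγ0 := (gammaC_pos hN hM).trans hγ
  obtain ⟨s, hs0, hs1, hs⟩ := balance_coercive hN hM hγ
  refine ⟨s, hs0, hs1, fun l ζ hζ ψ hψ => ?_⟩
  have ha : 0 < 1 / (M + 1) := by positivity
  have ha1 : 1 / (M + 1) < 1 := by rw [div_lt_one] <;> linarith
  obtain ⟨hf, hfE⟩ := integrable_weight_of_memLp hψ
  obtain ⟨t, ht, ht0, htm, htE⟩ := exists_powForm_seq hf hfE
  -- The sign of `b` turns `+ 2/(M+1) pqy` into `-2bpqy`.
  obtain ⟨hcO, O, hO, hOs⟩ := exists_kernelForm_eq (K := offKernel M 0 l) (b := -(1 / (M + 1)))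
    (by rw [abs_neg, abs_of_pos ha]; exact ha1.le) l
    (fun p q y => by rw [offKernel]; congr 1; ring) hψ ht
  obtain ⟨hcR, R, hR, hRs⟩ := exists_kernelForm_eq (K := regKernel l) (b := 1)
    (by simp) l (fun p q y => by rw [regKernel, mul_one]) hψ ht
  refine ⟨⟨integrable_diagIntegrand hM hζ hψ, hcO, hcR⟩, ?_⟩
  have hval : auxForm N M γ s ζ l ψ
      = ((s * Fdiag M ζ ψ + (N - 1) / Real.pi * (γ * R - O) : ℝ) : ℂ) := by
    rw [auxForm, Foff, Freg, hO, hR]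
    push_cast
    ring
  rw [hval, Complex.ofReal_im, Complex.ofReal_re]
  refine ⟨rfl, ?_⟩
  set E := ∫ p : ℝ, ‖(p : ℂ) ^ 2 * ψ p‖ ^ 2 / p ∂halfLine
  have hE : 0 ≤ E := by
    refine integral_nonneg_of_ae ?_
    filter_upwards [ae_halfLine_pos] with p hp
    simp only [Pi.zero_apply]; positivity
  have hN1 : (0 : ℝ) < (N - 1) / Real.pi := by
    have : (2 : ℝ) ≤ N := by exact_mod_cast hN
    exact div_pos (by linarith) Real.pi_pos
  have h1 := offDiagonal_le ha ha1 ht0 htm htE hE hRs hOs hγ0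
  have h2 := mul_le_mul_of_nonneg_left (le_Fdiag hM hζ hψ) hs0.le
  have h3 := mul_le_mul_of_nonneg_left h1 hN1.le
  have h4 : 0 ≤ s * (√(M * (M + 2)) / (M + 1)) + ((N : ℝ) - 1) / Real.pi *
      min 0 ((γ - balance (1 / (M + 1))) * (Real.pi ^ 2 / 2)) := by
    rcases min_choice 0 ((γ - balance (1 / (M + 1))) * (Real.pi ^ 2 / 2)) with h | h <;> rw [h]
    · positivity
    · exact hs
  have h5 := mul_nonneg h4 hE
  linarith
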